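/- Fix an integer $d\ge 2$. For each $n$ let $X_{1},\dots,X_{n}$ be independent random points, each uniformly distributed in the unit cube $[0,1]^d$, and let $$L_n=\min_{\sigma}\Big(\sum_{i=1}^{n-1}\|X_{\sigma(i)}-X_{\sigma(i+1)}\|+\|X_{\sigma(n)}-X_{\sigma(1)}\|\Big)$$ be the length of the optimal (closed) traveling salesman tour through them, where $\sigma$ ranges over the permutations of $\{1,\dots,n\}$ and $\|\cdot\|$ is the Euclidean norm. Then $L_n$ has fluctuations of order at least $n^{(d-2)/(2d)}$, in the following sense: there are constants $c_1,c_2>0$ and an integer $N$ such that for all $n\ge N$ and all real $a\le b$ with $b-a\le c_1 n^{(d-2)/(2d)}$, $$\mathbb{P}(a\le L_n\le b)\le 1-c_2 .$$ -/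

import Mathlib

open MeasureTheory ProbabilityTheory

/-- A sequence of real random variables `L n`, each on its own probability space `(Ω n, P n)`
(possibly all the same space), has fluctuations of order at least `δ n`: there are positive
constants `c₁`, `c₂` such that for all large `n`, every closed interval `[a, b]` of length at most
`c₁ * δ n` carries probability at most `1 - c₂` under the law of `L n`. -/
def FluctuationsAtLeast {Ω : ℕ → Type*} [∀ n, MeasurableSpace (Ω n)]
    (P : ∀ n, Measure (Ω n)) (L : ∀ n, Ω n → ℝ) (δ : ℕ → ℝ) : Prop :=
  ∃ c₁ c₂ : ℝ, 0 < c₁ ∧ 0 < c₂ ∧ ∃ N : ℕ, ∀ n : ℕ, N ≤ n →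
    ∀ a b : ℝ, a ≤ b → b - a ≤ c₁ * δ n →
      (P n).real {ω | a ≤ L n ω ∧ L n ω ≤ b} ≤ 1 - c₂

/-- The unit cube `[0,1]^d`. -/
def unitCube (d : ℕ) : Set (EuclideanSpace ℝ (Fin d)) :=
  {x | ∀ i, x i ∈ Set.Icc (0 : ℝ) 1}

/-- The Euclidean length of the closed tour that visits the points in the order
`x (σ 0), x (σ 1), …, x (σ (n - 1))` and then returns to `x (σ 0)`
(`finRotate n` is the cyclic successor `i ↦ i + 1` on `Fin n`). -/
noncomputable def tourLength {d n : ℕ} (x : Fin n → EuclideanSpace ℝ (Fin d))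
    (σ : Equiv.Perm (Fin n)) : ℝ :=
  ∑ i : Fin n, dist (x (σ i)) (x (σ (finRotate n i)))

/-- The length of the optimal traveling salesman tour through the points `x`: the minimum of the
tour length over the finitely many visiting orders. -/
noncomputable def optimalTourLength {d n : ℕ} (x : Fin n → EuclideanSpace ℝ (Fin d)) : ℝ :=
  ⨅ σ : Equiv.Perm (Fin n), tourLength x σ

/-!
The proof exhibits, for a typical sample, a number of order `n` of independent fair coin flips that
leave the law of the sample unchanged and each of which changes the optimal tour length, in a known
direction, by at least a constant times `n ^ (-1 / d)`. A sum of that many coin flips is spread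
over a range of order `√n * n ^ (-1 / d) = n ^ ((d - 2) / (2 d))`.

The coin flips are local moves. About `n` disjoint balls of radius of order `n ^ (-1 / d)` are
placed in the cube (`exists_grid`, `exists_mesh`), and in each of them a `Gadget` is marked: small
balls around the sites of a cluster, and small balls around companion sites, which are near a
translate of the cluster. The move of a gadget exchanges the cluster sites with their translates
(`swapMap`), which preserves the uniform distribution. If the gadget is occupied (`Gadget.IsOn`:
one point at each site and no further point in the ball), the move carries an isolated cluster to a
place where each of its points is next to a companion. This shortens the optimal tour, whatever
happens in the other gadgets (`Gadget.tsp_swap_insert_add_le`):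

* next to the companions, the points can be inserted into a tour at small cost (`tsp_union_le`);
* an optimal tour can leave an isolated cluster only in well separated directions, since otherwise
  a 2-opt move would shorten it (`card_leaving_le`). So the number of visits to the cluster is
  bounded by a constant depending on `d`, and if the cluster has more than twice as many points,
  some point has both of its tour neighbours in the cluster. The cluster sites are in general
  position, so leaving out that point already saves a definite amount (`tsp_sdiff_add_le`).

For a fixed sample, the tour length is thus a function of the set `W` of performed moves that drops
by at least `ε` whenever an occupied gadget is added to `W`. The sets `W` on which it takes values
in a half-open interval of length `ε` split into antichains, so Sperner's theorem bounds the number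
of `W` for which it lies in a given interval (`two_mul_card_filter_mem_Icc_le`). Each gadget is
occupied with probability bounded below (`measureReal_pi_exists_embedding`, `poisson_lower_bound`),
and averaging over `W` and the sample gives the bound (`measureReal_Icc_le_of_moves`,
`exists_fluctuation_bound`).
-/

/-! ### Closed tours as lists -/

/-- The length of the polygonal path through the points `x a`, for `a` running through a list. -/
noncomputable def pathLength {α E : Type*} [PseudoMetricSpace E] (x : α → E) : List α → ℝ
  | [] => 0
  | [_] => 0
  | a :: b :: t => dist (x a) (x b) + pathLength x (b :: t)

/-- The length of the closed polygon through the points `x a`, for `a` running through a list. -/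
noncomputable def cycleLength {α E : Type*} [PseudoMetricSpace E] (x : α → E) : List α → ℝ
  | [] => 0
  | a :: t => pathLength x (a :: (t ++ [a]))

section Lists

variable {α E : Type*} [PseudoMetricSpace E] (x : α → E)

lemma pathLength_append (l : List α) (a : α) (l' : List α) :
    pathLength x (l ++ a :: l') = pathLength x (l ++ [a]) + pathLength x (a :: l') := by
  induction l with
  | nil => simp [pathLength]
  | cons b t ih =>
    cases t with
    | nil => simp [pathLength]
    | cons c t => simp only [List.cons_append, pathLength] at ih ⊢; rw [ih]; ring

lemma pathLength_append_cons_cons (l : List α) (a b : α) (l' : List α) :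
    pathLength x (l ++ a :: b :: l') =
      pathLength x (l ++ [a]) + dist (x a) (x b) + pathLength x (b :: l') := by
  rw [pathLength_append, pathLength]; ring

lemma pathLength_reverse (l : List α) : pathLength x l.reverse = pathLength x l := by
  induction l with
  | nil => rfl
  | cons a t ih =>
    cases t with
    | nil => rfl
    | cons b t =>
      rw [pathLength, ← ih]
      simp only [List.reverse_cons, List.append_assoc, List.cons_append, List.nil_append]
      rw [pathLength_append_cons_cons, dist_comm]
      simp [pathLength, add_comm]

lemma pathLength_nonneg (l : List α) : 0 ≤ pathLength x l := by
  induction l with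
  | nil => exact le_rfl
  | cons a t ih =>
    cases t with
    | nil => exact le_rfl
    | cons b t => exact add_nonneg dist_nonneg ih

lemma cycleLength_append_comm (l l' : List α) :
    cycleLength x (l ++ l') = cycleLength x (l' ++ l) := by
  cases l with
  | nil => simp
  | cons a t =>
    cases l' with
    | nil => simp
    | cons b t' =>
      have h₁ := pathLength_append x (a :: t) b (t' ++ [a])
      have h₂ := pathLength_append x (b :: t') a (t ++ [b])
      simp only [List.cons_append, cycleLength, List.append_assoc] at h₁ h₂ ⊢
      linarith

lemma cycleLength_eq_of_isRotated {l l' : List α} (h : l ~r l') :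
    cycleLength x l = cycleLength x l' := by
  obtain ⟨n, hn, rfl⟩ := List.isRotated_iff_mod.1 h
  rw [List.rotate_eq_drop_append_take hn, cycleLength_append_comm, List.take_append_drop]

lemma cycleLength_reverse (l : List α) : cycleLength x l.reverse = cycleLength x l := by
  cases l with
  | nil => rfl
  | cons a t =>
    rw [List.reverse_cons, cycleLength_append_comm]
    simp only [List.cons_append, List.nil_append, cycleLength]
    rw [← pathLength_reverse x (a :: (t ++ [a]))]
    simp

lemma cycleLength_cons_cons (a b : α) (t : List α) :
    cycleLength x (a :: b :: t) = dist (x a) (x b) + pathLength x (b :: (t ++ [a])) := rfl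

/-- Dropping one stop between its neighbours `p` and `q`. -/
lemma cycleLength_cons_cons_cons (p z q : α) (t : List α) :
    cycleLength x (p :: z :: q :: t) =
      cycleLength x (p :: q :: t) + (dist (x p) (x z) + dist (x z) (x q) - dist (x p) (x q)) := by
  simp only [cycleLength, List.cons_append, pathLength]; ring

lemma cycleLength_le_cons (a : α) (t : List α) : cycleLength x t ≤ cycleLength x (a :: t) := by
  cases t with
  | nil => exact pathLength_nonneg x _
  | cons b t =>
    rw [cycleLength_eq_of_isRotated x (l := a :: b :: t) (l' := b :: (t ++ [a]))
      (by simpa using List.isRotated_append (l := [a]) (l' := b :: t))]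
    have h1 := pathLength_append_cons_cons x (b :: t) a b []
    have h2 : ∀ t : List α, ∀ c, pathLength x (c :: (t ++ [b])) ≤
        pathLength x (c :: (t ++ [a])) + dist (x a) (x b) := by
      intro t
      induction t with
      | nil => intro c; simpa [pathLength] using dist_triangle _ _ _
      | cons e t ih => intro c; simp only [List.cons_append, pathLength]; linarith [ih e]
    have h3 := h2 t b
    simp only [List.cons_append, cycleLength, List.append_assoc, List.nil_append] at h1 ⊢
    rw [h1]; simpa [pathLength] using h3

lemma cycleLength_insert_le (c z : α) (t : List α) :
    cycleLength x (c :: z :: t) ≤ cycleLength x (c :: t) + 2 * dist (x z) (x c) := by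
  cases t with
  | nil => simp [cycleLength, pathLength, dist_comm (x c) (x z)]; linarith
  | cons b t =>
    rw [cycleLength_cons_cons_cons]
    have := dist_triangle (x z) (x c) (x b)
    rw [dist_comm (x c) (x z)]; linarith

/-- Every stop of a closed tour can be rotated to the front. -/
lemma exists_isRotated_cons {l : List α} {a : α} (h : a ∈ l) : ∃ t, l ~r a :: t := by
  obtain ⟨s, t, rfl⟩ := List.append_of_mem h
  exact ⟨t ++ s, List.isRotated_append⟩

variable [DecidableEq α]

/-- In a tour without repetitions the successor of a stop is unique. -/
lemma eq_of_isRotated_cons_cons {l : List α} (hl : l.Nodup) {a b b' : α} {t t' : List α}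
    (h : l ~r a :: b :: t) (h' : l ~r a :: b' :: t') : b = b' := by
  have hr : (a :: b :: t) ~r (a :: b' :: t') := h.symm.trans h'
  have hn : (a :: b :: t).Nodup := h.perm.nodup_iff.1 hl
  have := List.isRotated_next_eq hr hn (x := a) (by simp)
  rwa [List.next_cons_cons_eq, List.next_cons_cons_eq] at this

/-- The 2-opt move: two steps `x₁ → b₁` and `x₂ → b₂` of a tour may be traded for `x₁ → x₂` and `b₁
→ b₂`, running through the part of the tour between them backwards. -/
lemma exists_twoOpt {l : List α} (hl : l.Nodup) {x₁ x₂ b₁ b₂ : α} {t₁ t₂ : List α}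
    (h₁ : l ~r x₁ :: b₁ :: t₁) (h₂ : l ~r x₂ :: b₂ :: t₂) (hne : x₁ ≠ x₂) (h12 : x₁ ≠ b₂)
    (h21 : b₁ ≠ x₂) :
    ∃ l', l'.Perm l ∧ cycleLength x l' = cycleLength x l - dist (x x₁) (x b₁) -
      dist (x x₂) (x b₂) + dist (x x₁) (x x₂) + dist (x b₁) (x b₂) := by
  have hx₂ : x₂ ∈ t₁ := by
    have : x₂ ∈ x₁ :: b₁ :: t₁ := h₁.perm.mem_iff.1 (h₂.perm.mem_iff.2 (by simp))
    simpa [hne.symm, h21.symm] using this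
  obtain ⟨M, N, rfl⟩ := List.append_of_mem hx₂
  have hr : l ~r x₂ :: (N ++ (x₁ :: b₁ :: M)) := h₁.trans
    (by simpa using List.isRotated_append (l := x₁ :: b₁ :: M) (l' := x₂ :: N))
  cases N with
  | nil => exact absurd (eq_of_isRotated_cons_cons hl h₂ hr).symm h12
  | cons y N =>
    obtain rfl : b₂ = y := eq_of_isRotated_cons_cons hl h₂ hr
    refine ⟨x₁ :: x₂ :: (M.reverse ++ b₁ :: b₂ :: N), ?_, ?_⟩
    · refine List.Perm.trans ?_ h₁.perm.symm
      refine List.Perm.cons _ ?_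
      have : x₂ :: (M.reverse ++ b₁ :: b₂ :: N) = (b₁ :: (M ++ [x₂])).reverse ++ b₂ :: N := by simp
      rw [this, show b₁ :: (M ++ x₂ :: b₂ :: N) = (b₁ :: (M ++ [x₂])) ++ b₂ :: N by simp]
      exact (List.reverse_perm _).append_right _
    · rw [cycleLength_eq_of_isRotated x h₁]
      simp only [cycleLength_cons_cons, List.append_assoc, List.cons_append]
      rw [← List.cons_append (as := M), ← List.cons_append (as := M.reverse),
        pathLength_append_cons_cons, pathLength_append_cons_cons,
        ← pathLength_reverse x ((x₂ :: M.reverse) ++ [b₁])]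
      simp
      ring

end Lists

/-! ### The optimal closed tour through finitely many labelled points -/

/-- The length of a shortest closed tour through the points `x a`, `a ∈ s`: the minimum over the
finitely many enumerations of `s`. -/
noncomputable def tsp {α E : Type*} [PseudoMetricSpace E] (x : α → E) (s : Finset α) : ℝ :=
  sInf (cycleLength x '' {l : List α | s.val = (l : Multiset α)})

section Tsp

variable {α E : Type*} [PseudoMetricSpace E] (x : α → E)

lemma finite_setOf_val_eq_coe (s : Finset α) : {l : List α | s.val = (l : Multiset α)}.Finite := by
  refine (List.finite_toSet s.toList.permutations).subset fun l hl => ?_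
  rw [Set.mem_ofPred_eq, List.mem_permutations, ← Multiset.coe_eq_coe, Finset.coe_toList]
  exact Eq.symm hl

lemma tsp_le {s : Finset α} {l : List α} (h : s.val = (l : Multiset α)) :
    tsp x s ≤ cycleLength x l :=
  csInf_le ((finite_setOf_val_eq_coe s).image _).bddBelow ⟨l, h, rfl⟩

lemma exists_tsp_eq (s : Finset α) :
    ∃ l : List α, s.val = (l : Multiset α) ∧ tsp x s = cycleLength x l := by
  obtain ⟨l, hl, h⟩ := Set.Nonempty.csInf_mem
    (s := cycleLength x '' {l : List α | s.val = (l : Multiset α)})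
    ⟨_, s.toList, by simp, rfl⟩ ((finite_setOf_val_eq_coe s).image _)
  exact ⟨l, hl, h.symm⟩

lemma pathLength_congr {x y : α → E} {l : List α} (h : ∀ a ∈ l, x a = y a) :
    pathLength x l = pathLength y l := by
  induction l with
  | nil => rfl
  | cons a t ih =>
    cases t with
    | nil => rfl
    | cons b t =>
      rw [pathLength, pathLength, h a (by simp), h b (by simp),
        ih fun c hc => h c (List.mem_cons_of_mem _ hc)]

lemma cycleLength_congr {x y : α → E} {l : List α} (h : ∀ a ∈ l, x a = y a) :
    cycleLength x l = cycleLength y l := by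
  cases l with
  | nil => rfl
  | cons a t => exact pathLength_congr (by simp only [List.mem_cons, List.mem_append]; grind)

lemma tsp_congr {x y : α → E} {s : Finset α} (h : ∀ a ∈ s, x a = y a) : tsp x s = tsp y s := by
  refine congrArg sInf (Set.image_congr fun l hl => cycleLength_congr fun a ha => h a ?_)
  rw [← Finset.mem_val, show s.val = (l : Multiset α) from hl]; exact ha

variable [DecidableEq α]

lemma val_erase_eq_of_perm {s : Finset α} {l t : List α} {a : α}
    (hs : s.val = (l : Multiset α)) (h : l.Perm (a :: t)) :
    (s.erase a).val = (t : Multiset α) := by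
  rw [Finset.erase_val, hs, Multiset.coe_eq_coe.2 h]
  simp

lemma tsp_erase_le (s : Finset α) (a : α) : tsp x (s.erase a) ≤ tsp x s := by
  by_cases ha : a ∈ s
  · obtain ⟨l, hl, h⟩ := exists_tsp_eq x s
    obtain ⟨t, ht⟩ := exists_isRotated_cons (l := l) (a := a) (by
      rw [← Finset.mem_val, hl] at ha; exact ha)
    rw [h, cycleLength_eq_of_isRotated x ht]
    exact (tsp_le x (val_erase_eq_of_perm hl ht.perm)).trans (cycleLength_le_cons x a t)
  · rw [Finset.erase_eq_of_notMem ha]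

lemma tsp_sdiff_le (s Z : Finset α) : tsp x (s \ Z) ≤ tsp x s := by
  induction Z using Finset.induction_on with
  | empty => simp
  | insert a Z _ ih =>
    rw [Finset.sdiff_insert]
    exact (tsp_erase_le x _ a).trans ih

lemma tsp_insert_le {s : Finset α} {c z : α} (hc : c ∈ s) (hz : z ∉ s) :
    tsp x (insert z s) ≤ tsp x s + 2 * dist (x z) (x c) := by
  obtain ⟨l, hl, h⟩ := exists_tsp_eq x s
  obtain ⟨t, ht⟩ := exists_isRotated_cons (l := l) (a := c) (by
      rw [← Finset.mem_val, hl] at hc; exact hc)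
  rw [h, cycleLength_eq_of_isRotated x ht]
  refine (tsp_le x ?_).trans (cycleLength_insert_le x c z t)
  rw [Finset.insert_val_of_notMem hz, hl, Multiset.coe_eq_coe.2 ht.perm]
  simp [Multiset.cons_swap, ← Multiset.cons_coe]

/-- Adding to a tour stops that each lie within `η` of an old stop costs at most `2 η` per stop. -/
lemma tsp_union_le {s Z : Finset α} (hZ : Disjoint s Z) {η : ℝ}
    (h : ∀ z ∈ Z, ∃ c ∈ s, dist (x z) (x c) ≤ η) :
    tsp x (s ∪ Z) ≤ tsp x s + Z.card * (2 * η) := by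
  induction Z using Finset.induction_on with
  | empty => simp
  | insert a Z haZ ih =>
    rw [Finset.disjoint_insert_right] at hZ
    obtain ⟨c, hc, hd⟩ := h a (by simp)
    rw [Finset.union_insert, Finset.card_insert_of_notMem haZ]
    have h1 := ih hZ.2 fun z hz => h z (by simp [hz])
    have h2 := tsp_insert_le x (s := s ∪ Z) (c := c) (z := a) (by simp [hc]) (by simp [haZ, hZ.1])
    push_cast
    linarith

end Tsp

lemma pathLength_ofFn {E : Type*} [PseudoMetricSpace E] {α : Type*} (x : α → E) {n : ℕ}
    (g : Fin (n + 1) → α) :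
    pathLength x (List.ofFn g) = ∑ i : Fin n, dist (x (g i.castSucc)) (x (g i.succ)) := by
  induction n with
  | zero => simp [pathLength]
  | succ n ih =>
    rw [List.ofFn_succ, List.ofFn_succ, pathLength, Fin.sum_univ_succ,
      ← List.ofFn_succ (f := fun i => g i.succ), ih]
    rfl

lemma cycleLength_ofFn {d n : ℕ} (x : Fin n → EuclideanSpace ℝ (Fin d))
    (σ : Equiv.Perm (Fin n)) : cycleLength x (List.ofFn σ) = tourLength x σ := by
  cases n with
  | zero => simp [cycleLength, tourLength]
  | succ n =>
    have h : cycleLength x (List.ofFn σ) =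
        pathLength x (List.ofFn (Fin.snoc (α := fun _ => Fin (n + 1)) σ (σ 0))) := by
      rw [List.ofFn_succ' (n := n + 1)]
      simp only [Fin.snoc_castSucc, Fin.snoc_last, List.concat_eq_append]
      rw [List.ofFn_succ]
      rfl
    rw [h, pathLength_ofFn, tourLength, Fin.sum_univ_castSucc, Fin.sum_univ_castSucc]
    congr 1
    · refine Finset.sum_congr rfl fun i _ => ?_
      rw [Fin.snoc_castSucc, ← Fin.castSucc_succ, Fin.snoc_castSucc]
      congr 3
      ext
      simp
    · rw [Fin.snoc_castSucc, Fin.succ_last, Fin.snoc_last, finRotate_last]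

lemma optimalTourLength_eq_tsp {d n : ℕ} (x : Fin n → EuclideanSpace ℝ (Fin d)) :
    optimalTourLength x = tsp x Finset.univ := by
  refine le_antisymm ?_ (le_ciInf fun σ => ?_)
  · obtain ⟨l, hl, h⟩ := exists_tsp_eq x Finset.univ
    have hn : l.Nodup := by rw [← Multiset.coe_nodup, ← hl]; exact Finset.univ.nodup
    have hlen : l.length = n := by
      rw [← Multiset.coe_card, ← hl]; simp
    obtain ⟨g, rfl⟩ : ∃ g : Fin n → Fin n, l = List.ofFn g :=
      ⟨fun i => l.get (i.cast hlen.symm), by rw [← List.ofFn_congr hlen, List.ofFn_get]⟩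
    obtain ⟨σ, rfl⟩ : ∃ σ : Equiv.Perm (Fin n), ⇑σ = g :=
      ⟨Equiv.ofBijective g (Finite.injective_iff_bijective.1 (List.nodup_ofFn.1 hn)), rfl⟩
    rw [h, cycleLength_ofFn]
    exact ciInf_le (Set.finite_range _).bddBelow σ
  · rw [← cycleLength_ofFn]
    refine tsp_le x ?_
    have hn : (List.ofFn σ).Nodup := List.nodup_ofFn.2 σ.injective
    have : (⟨(List.ofFn σ : List (Fin n)), hn⟩ : Finset (Fin n)) = Finset.univ := by
      ext i
      simp only [Finset.mem_univ, iff_true]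
      exact List.mem_ofFn.2 ⟨σ.symm i, by simp⟩
    rw [← this]

/-! ### Isolated clusters -/

section Cluster

variable {E : Type*} [NormedAddCommGroup E] [NormedSpace ℝ E]

lemma exists_finset_cover_sphere [FiniteDimensional ℝ E] :
    ∃ T : Finset E, ∀ u : E, ‖u‖ = 1 → ∃ c ∈ T, dist u c < 1 / 4 := by
  have : ProperSpace E := FiniteDimensional.proper ℝ E
  obtain ⟨t, -, ht, hc⟩ := (isCompact_sphere (0 : E) 1).finite_cover_balls
    (e := 1 / 4) (by norm_num)
  refine ⟨ht.toFinset, fun u hu => ?_⟩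
  have := hc (show u ∈ Metric.sphere (0 : E) 1 by simpa using hu)
  simpa using this

/-- Two segments that start close to each other in almost the same direction have end points that
are closer to each other than the sum of the lengths, by an amount proportional to the length. -/
lemma dist_le_of_dist_direction_le {x₁ x₂ b₁ b₂ : E} (h₁ : x₁ ≠ b₁)
    (h : dist (‖b₁ - x₁‖⁻¹ • (b₁ - x₁)) (‖b₂ - x₂‖⁻¹ • (b₂ - x₂)) ≤ 1 / 2)
    (hle : dist x₁ b₁ ≤ dist x₂ b₂) :
    dist b₁ b₂ ≤ dist x₁ x₂ + dist x₂ b₂ - dist x₁ b₁ / 2 := by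
  rw [dist_comm x₁ b₁, dist_comm x₂ b₂] at *
  simp only [dist_eq_norm] at *
  have p₁ : 0 < ‖b₁ - x₁‖ := norm_pos_iff.2 (sub_ne_zero.2 h₁.symm)
  have p₂ : 0 < ‖b₂ - x₂‖ := p₁.trans_le hle
  set t₁ := ‖b₁ - x₁‖ with ht₁
  set t₂ := ‖b₂ - x₂‖ with ht₂
  set u₁ := t₁⁻¹ • (b₁ - x₁) with hu₁
  set u₂ := t₂⁻¹ • (b₂ - x₂) with hu₂
  have e₁ : b₁ - x₁ = t₁ • u₁ := by rw [hu₁, smul_inv_smul₀ p₁.ne']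
  have e₂ : b₂ - x₂ = t₂ • u₂ := by rw [hu₂, smul_inv_smul₀ p₂.ne']
  have n₂ : ‖u₂‖ = 1 := by
    rw [hu₂, norm_smul, norm_inv, ← ht₂, Real.norm_of_nonneg p₂.le, inv_mul_cancel₀ p₂.ne']
  have key : b₁ - b₂ = (x₁ - x₂) + t₁ • (u₁ - u₂) + (t₁ - t₂) • u₂ := by
    have : b₁ - b₂ = (x₁ - x₂) + (b₁ - x₁) - (b₂ - x₂) := by abel
    rw [this, e₁, e₂]; module
  rw [key]
  refine (norm_add₃_le).trans ?_
  rw [norm_smul, norm_smul, n₂, Real.norm_of_nonneg p₁.le, Real.norm_of_nonpos (by linarith)]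
  nlinarith

variable {α : Type*} [DecidableEq α]

/-- An optimal tour leaves an isolated cluster `Z` only boundedly often: two steps out of `Z` in
nearly the same direction could be replaced by a step inside `Z` and a step outside `Z`, with a
gain. -/
lemma card_leaving_le {T : Finset E} (hT : ∀ u : E, ‖u‖ = 1 → ∃ c ∈ T, dist u c < 1 / 4)
    {x : α → E} {s Z : Finset α} {e : E} {r R : ℝ}
    (hZ : ∀ z ∈ Z, dist (x z) e ≤ r) (hS : ∀ a ∈ s \ Z, R ≤ dist (x a) e)
    (hrR : 11 * r < 3 * R) {l : List α} (hl : s.val = (l : Multiset α))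
    (hopt : tsp x s = cycleLength x l) (Z' : Finset α)
    (hZ' : ∀ z ∈ Z', z ∈ Z ∧ ∃ b t, l ~r z :: b :: t ∧ b ∉ Z) : Z'.card ≤ T.card := by
  have hln : l.Nodup := by rw [← Multiset.coe_nodup, ← hl]; exact s.nodup
  choose! hmem b t hr hb using hZ'
  have hfar : ∀ z ∈ Z', R - r ≤ dist (x z) (x (b z)) := fun z hz => by
    have hbs : b z ∈ s := by
      rw [← Finset.mem_val, hl, Multiset.mem_coe, (hr z hz).perm.mem_iff]; simp
    have h1 := hS (b z) (by simp [hbs, hb z hz])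
    have h2 := hZ z (hmem z hz)
    have h3 := dist_triangle (x (b z)) (x z) e
    rw [dist_comm (x z) (x (b z))]; linarith
  have hrn : ∀ z ∈ Z', 0 ≤ r := fun z hz => dist_nonneg.trans (hZ z (hmem z hz))
  have hpos : ∀ z ∈ Z', 0 < dist (x z) (x (b z)) := fun z hz => by
    linarith [hfar z hz, hrn z hz]
  have hdir : ∀ z ∈ Z', ∃ c ∈ T,
      dist (‖x (b z) - x z‖⁻¹ • (x (b z) - x z)) c < 1 / 4 := fun z hz => by
    refine hT _ ?_
    have := hpos z hz
    rw [dist_comm, dist_eq_norm] at this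
    rw [norm_smul, norm_inv, norm_norm, inv_mul_cancel₀ this.ne']
  choose! c hcT hc using hdir
  refine Finset.card_le_card_of_injOn c hcT fun z₁ h₁ z₂ h₂ h12 => ?_
  by_contra hne
  wlog hle : dist (x z₁) (x (b z₁)) ≤ dist (x z₂) (x (b z₂)) generalizing z₁ z₂
  · exact this _ h₂ _ h₁ h12.symm (Ne.symm hne) (le_of_not_ge hle)
  rw [Finset.mem_coe] at h₁ h₂
  obtain ⟨l', hp, hlen⟩ := exists_twoOpt x hln (hr z₁ h₁) (hr z₂ h₂) hne
    (fun h => hb z₂ h₂ (h ▸ hmem z₁ h₁)) (fun h => hb z₁ h₁ (h ▸ hmem z₂ h₂))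
  have hmin : cycleLength x l ≤ cycleLength x l' := by
    rw [← hopt]; exact tsp_le x (by rw [hl, Multiset.coe_eq_coe.2 hp])
  have hd := dist_le_of_dist_direction_le (x₁ := x z₁) (x₂ := x z₂) (b₁ := x (b z₁))
    (b₂ := x (b z₂)) (dist_pos.1 (hpos z₁ h₁))
    (by
      have e1 := hc z₁ h₁
      have e2 := hc z₂ h₂
      rw [h12] at e1
      linarith [dist_triangle_right (‖x (b z₁) - x z₁‖⁻¹ • (x (b z₁) - x z₁))
        (‖x (b z₂) - x z₂‖⁻¹ • (x (b z₂) - x z₂)) (c z₂)]) hle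
  have hzz : dist (x z₁) (x z₂) ≤ 2 * r := by
    linarith [dist_triangle_right (x z₁) (x z₂) e, hZ z₁ (hmem z₁ h₁), hZ z₂ (hmem z₂ h₂)]
  linarith [hfar z₁ h₁]

/-- An isolated cluster with more points than twice the possible number of exits contains a point
whose two neighbours on an optimal tour belong to the cluster, so if no three of its points are
nearly aligned, leaving out the cluster shortens the optimal tour by a definite amount. -/
lemma tsp_sdiff_add_le {T : Finset E} (hT : ∀ u : E, ‖u‖ = 1 → ∃ c ∈ T, dist u c < 1 / 4)
    {x : α → E} {s Z : Finset α} {e : E} {r R δ : ℝ} (hsub : Z ⊆ s)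
    (hZ : ∀ z ∈ Z, dist (x z) e ≤ r) (hS : ∀ a ∈ s \ Z, R ≤ dist (x a) e)
    (hrR : 11 * r < 3 * R) (hcard : 2 * T.card < Z.card) (hcard3 : 3 ≤ Z.card)
    (hδ : ∀ p ∈ Z, ∀ z ∈ Z, ∀ q ∈ Z, p ≠ z → z ≠ q → p ≠ q →
      δ ≤ dist (x p) (x z) + dist (x z) (x q) - dist (x p) (x q)) :
    tsp x (s \ Z) + δ ≤ tsp x s := by
  classical
  obtain ⟨l, hl, hopt⟩ := exists_tsp_eq x s
  have hl' : s.val = (l.reverse : Multiset α) := by rw [hl]; simp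
  have h1 := card_leaving_le hT hZ hS hrR hl hopt
    (Z.filter fun z => ∃ b t, l ~r z :: b :: t ∧ b ∉ Z) (fun z hz => by simpa using hz)
  have h2 := card_leaving_le hT hZ hS hrR hl' (by rw [cycleLength_reverse]; exact hopt)
    (Z.filter fun z => ∃ b t, l.reverse ~r z :: b :: t ∧ b ∉ Z) (fun z hz => by simpa using hz)
  obtain ⟨z, hzZ, hz⟩ : ∃ z ∈ Z, z ∉ (Z.filter fun z => ∃ b t, l ~r z :: b :: t ∧ b ∉ Z) ∪
      (Z.filter fun z => ∃ b t, l.reverse ~r z :: b :: t ∧ b ∉ Z) := by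
    by_contra! hcon
    have := (Finset.card_le_card (s := Z) (fun z hz => hcon z hz)).trans (Finset.card_union_le _ _)
    omega
  simp only [Finset.mem_union, Finset.mem_filter, hzZ, true_and, not_or, not_exists, not_and,
    not_not] at hz
  have hln : l.Nodup := by rw [← Multiset.coe_nodup, ← hl]; exact s.nodup
  have hlen : 3 ≤ l.length := by
    have : l.length = s.card := by rw [← Multiset.coe_card, ← hl]; rfl
    rw [this]; exact hcard3.trans (Finset.card_le_card hsub)
  obtain ⟨t, ht⟩ := exists_isRotated_cons (l := l) (a := z) (by
      rw [← Multiset.mem_coe, ← hl]; exact hsub hzZ)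
  have htl : 2 ≤ t.length := by
    have := ht.perm.length_eq
    simp at this; omega
  obtain ⟨q, t, rfl⟩ : ∃ q t', t = q :: t' := List.exists_cons_of_length_pos (by omega)
  obtain ⟨u, p, rfl⟩ : ∃ u p, t = u ++ [p] := by
    rcases List.eq_nil_or_concat t with rfl | ⟨u, p, h⟩
    · simp at htl
    · exact ⟨u, p, by simpa using h⟩
  have hq : q ∈ Z := hz.1 _ _ ht
  have ht2 : l ~r p :: z :: q :: u :=
    ht.trans (by simpa using List.isRotated_append (l := z :: q :: u) (l' := [p]))
  have hp : p ∈ Z := by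
    refine hz.2 p (q :: u).reverse ?_
    have := ht.reverse
    refine this.trans ?_
    simpa using List.isRotated_append (l := p :: (q :: u).reverse) (l' := [z])
  have hnd : (p :: z :: q :: u).Nodup := ht2.perm.nodup_iff.1 hln
  simp only [List.nodup_cons, List.mem_cons, not_or] at hnd
  have hδ' := hδ p hp z hzZ q hq hnd.1.1 hnd.2.1.1 hnd.1.2.1
  have hle : tsp x (s.erase z) ≤ cycleLength x (p :: q :: u) := by
    refine tsp_le x (val_erase_eq_of_perm hl (ht2.perm.trans ?_))
    exact List.Perm.swap _ _ _
  have hss : s \ Z = s.erase z \ Z := by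
    ext a; simp only [Finset.mem_sdiff, Finset.mem_erase]; grind
  rw [hss, hopt, cycleLength_eq_of_isRotated x ht2, cycleLength_cons_cons_cons]
  linarith [tsp_sdiff_le x (s.erase z) Z]

end Cluster

/-! ### Anticoncentration of strictly monotone functions on the hypercube -/

lemma centralBinom_sq_mul_le (n : ℕ) : n.centralBinom ^ 2 * (2 * n + 1) ≤ 16 ^ n := by
  induction n with
  | zero => simp
  | succ n ih =>
    have h := Nat.succ_mul_centralBinom_succ n
    have key : (n + 1) ^ 2 * ((n + 1).centralBinom ^ 2 * (2 * (n + 1) + 1)) ≤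
        (n + 1) ^ 2 * 16 ^ (n + 1) := by
      calc (n + 1) ^ 2 * ((n + 1).centralBinom ^ 2 * (2 * (n + 1) + 1))
          = ((n + 1) * (n + 1).centralBinom) ^ 2 * (2 * n + 3) := by ring
        _ = (n.centralBinom ^ 2 * (2 * n + 1)) * (4 * ((2 * n + 1) * (2 * n + 3))) := by
          rw [h]; ring
        _ ≤ 16 ^ n * (4 * (4 * (n + 1) ^ 2)) := by
          refine Nat.mul_le_mul ih (Nat.mul_le_mul_left _ ?_)
          nlinarith
        _ = (n + 1) ^ 2 * 16 ^ (n + 1) := by ring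
    exact Nat.le_of_mul_le_mul_left key (by positivity)

lemma choose_half_sq_mul_le (g : ℕ) : (g.choose (g / 2)) ^ 2 * g ≤ 4 ^ g := by
  obtain ⟨m, rfl | rfl⟩ := g.even_or_odd'
  · rw [Nat.mul_div_cancel_left _ two_pos, ← Nat.centralBinom_eq_two_mul_choose, pow_mul]
    exact (Nat.mul_le_mul_left _ (Nat.le_succ _)).trans (centralBinom_sq_mul_le m)
  · have h1 : (2 * m + 1) / 2 = m := by omega
    have h2 : 2 * (2 * m + 1).choose m = (m + 1).centralBinom := by
      rw [Nat.centralBinom_eq_two_mul_choose, show 2 * (m + 1) = 2 * m + 1 + 1 by ring,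
        Nat.choose_succ_succ, ← Nat.choose_symm_half]; ring
    have h3 := centralBinom_sq_mul_le (m + 1)
    rw [← h2] at h3
    rw [h1]
    have : (16 : ℕ) ^ (m + 1) = 4 * 4 ^ (2 * m + 1) := by
      rw [show (16 : ℕ) = 4 ^ 2 by norm_num, ← pow_mul, ← pow_succ']; ring_nf
    nlinarith

/-- A set function that drops by at least `ε` whenever an element is added falls into a given
half-open interval of length `ε` only along an antichain; by Sperner's theorem it takes values in
an interval of length `h ε` at most `(h + 1) * (g.choose (g / 2))` times. -/
lemma card_filter_mem_Icc_le {ι : Type*} [Fintype ι] [DecidableEq ι] (f : Finset ι → ℝ) {ε : ℝ}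
    (hε : 0 < ε) (hf : ∀ j W, j ∉ W → f (insert j W) + ε ≤ f W) {a b : ℝ} (h : ℕ)
    (hab : b - a ≤ h * ε) :
    (Finset.univ.filter fun W => f W ∈ Set.Icc a b).card ≤
      (h + 1) * (Fintype.card ι).choose (Fintype.card ι / 2) := by
  have hanti : ∀ (D W : Finset ι), Disjoint W D → f (W ∪ D) + D.card * ε ≤ f W := by
    intro D
    induction D using Finset.induction_on with
    | empty => intro W _; simp
    | insert j D hj ih =>
      intro W hW
      rw [Finset.disjoint_insert_right] at hW
      have h1 := hf j (W ∪ D) (by simp [hW.1, hj])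
      have h2 := ih W hW.2
      rw [Finset.union_insert, Finset.card_insert_of_notMem hj]
      push_cast; linarith
  have hlt : ∀ W W' : Finset ι, W ⊆ W' → W ≠ W' → f W' + ε ≤ f W := by
    intro W W' hs hne
    have h1 := hanti (W' \ W) W Finset.disjoint_sdiff
    rw [Finset.union_sdiff_of_subset hs] at h1
    have h2 : 1 ≤ (W' \ W).card := by
      rw [Nat.one_le_iff_ne_zero, Ne, Finset.card_eq_zero, Finset.sdiff_eq_empty_iff_subset]
      exact fun h => hne (hs.antisymm h)
    have h3 : (1 : ℝ) ≤ ((W' \ W).card : ℝ) := by exact_mod_cast h2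
    nlinarith
  calc (Finset.univ.filter fun W => f W ∈ Set.Icc a b).card
      ≤ ((Finset.range (h + 1)).biUnion fun t => Finset.univ.filter fun W =>
          a + t * ε ≤ f W ∧ f W < a + (t + 1) * ε).card := by
        refine Finset.card_le_card fun W hW => ?_
        simp only [Finset.mem_filter, Finset.mem_univ, true_and, Set.mem_Icc] at hW
        have hn : 0 ≤ (f W - a) / ε := div_nonneg (by linarith) hε.le
        have h1 := (le_div_iff₀ hε).1 (Nat.floor_le hn)
        have h2 := (div_lt_iff₀ hε).1 (Nat.lt_floor_add_one ((f W - a) / ε))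
        simp only [Finset.mem_biUnion, Finset.mem_range, Finset.mem_filter, Finset.mem_univ,
          true_and]
        refine ⟨⌊(f W - a) / ε⌋₊, ?_, by linarith, by linarith⟩
        rw [Nat.lt_succ_iff]
        refine Nat.floor_le_of_le ?_
        rw [div_le_iff₀ hε]; linarith
    _ ≤ (Finset.range (h + 1)).card * (Fintype.card ι).choose (Fintype.card ι / 2) := by
        refine Finset.card_biUnion_le_card_mul _ _ _ fun t _ => IsAntichain.sperner ?_
        intro W hW W' hW' hne hs
        simp only [Finset.coe_filter, Finset.mem_univ, true_and, Set.mem_ofPred_eq] at hW hW'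
        have := hlt W W' hs hne
        linarith [hW.2, hW'.1]
    _ = _ := by rw [Finset.card_range]

/-- A set function that drops by at least `ε` whenever an element of `G` is added takes values in
an interval of length at most `ε * √|G| / 8` on at most half of all sets. -/
lemma two_mul_card_filter_mem_Icc_le {ι : Type*} [Fintype ι] [DecidableEq ι] (f : Finset ι → ℝ)
    (G : Finset ι) {ε : ℝ} (hε : 0 < ε) (hf : ∀ j ∈ G, ∀ W, j ∉ W → f (insert j W) + ε ≤ f W)
    (hG : 64 ≤ G.card) {a b : ℝ} (hab : b - a ≤ ε * (√G.card / 8)) :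
    2 * (Finset.univ.filter fun W => f W ∈ Set.Icc a b).card ≤ 2 ^ Fintype.card ι := by
  set g := G.card with hg
  set h := ⌈√(g : ℝ) / 8⌉₊ with hh
  have hs8 : 8 ≤ √(g : ℝ) := by
    rw [Real.le_sqrt (by norm_num) (by positivity)]; norm_num; exact_mod_cast hG
  have hslice : 2 * ((h + 1) * g.choose (g / 2)) ≤ 2 ^ g := by
    have h1 : ((h : ℝ) + 1) ≤ √g / 2 := by
      have := (Nat.ceil_lt_add_one (show 0 ≤ √(g : ℝ) / 8 by positivity)).le
      rw [← hh] at this; linarith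
    have h2 : (g.choose (g / 2) : ℝ) * √g ≤ 2 ^ g := by
      refine le_of_sq_le_sq ?_ (by positivity)
      rw [mul_pow, Real.sq_sqrt (by positivity), ← pow_mul, mul_comm g 2, pow_mul]
      have := choose_half_sq_mul_le g
      norm_num
      exact_mod_cast this
    have h3 : (2 : ℝ) * ((h + 1) * g.choose (g / 2)) ≤ 2 ^ g := by
      refine le_trans ?_ h2
      have : (0 : ℝ) ≤ g.choose (g / 2) := by positivity
      nlinarith
    exact_mod_cast h3
  -- the sets are sorted by their part outside `G`; on each class the previous bound applies
  have hfib : ∀ U ∈ Gᶜ.powerset,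
      ((Finset.univ.filter fun W => f W ∈ Set.Icc a b).filter fun W => W \ G = U).card ≤
        (h + 1) * g.choose (g / 2) := by
    intro U hU
    rw [Finset.mem_powerset] at hU
    have hUG : ∀ j ∈ G, j ∉ U := fun j hj hjU => by simpa [hj] using hU hjU
    have hcube := card_filter_mem_Icc_le
      (fun A : Finset G => f (A.map (Function.Embedding.subtype _) ∪ U)) hε
      (fun j A hjA => by
        rw [Finset.map_insert, Finset.insert_union]
        exact hf j j.2 _ (by simp [hjA, hUG j j.2]))
      (a := a) (b := b) h (by
        refine hab.trans ?_
        rw [mul_comm]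
        exact mul_le_mul_of_nonneg_right (Nat.le_ceil _) hε.le)
    rw [Fintype.card_coe, ← hg] at hcube
    refine le_trans ?_ hcube
    have hrec : ∀ W : Finset ι, W \ G = U →
        (W.subtype (· ∈ G)).map (Function.Embedding.subtype _) ∪ U = W := by
      rintro W rfl
      rw [Finset.subtype_map, Finset.filter_mem_eq_inter, Finset.union_comm,
        Finset.sdiff_union_inter]
    refine Finset.card_le_card_of_injOn (fun W => W.subtype (· ∈ G)) ?_ ?_
    · intro W hW
      simp only [Finset.coe_filter, Finset.mem_filter, Finset.mem_univ, true_and,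
        Set.mem_ofPred_eq] at hW ⊢
      rw [hrec W hW.2]; exact hW.1
    · intro W hW W' hW' hWW
      simp only [Finset.coe_filter, Finset.mem_filter, Finset.mem_univ, true_and,
        Set.mem_ofPred_eq] at hW hW'
      simp only at hWW
      rw [← hrec W hW.2, ← hrec W' hW'.2, hWW]
  have hall := Finset.card_le_mul_card_image_of_maps_to
    (s := Finset.univ.filter fun W => f W ∈ Set.Icc a b) (f := fun W => W \ G)
    (t := Gᶜ.powerset) (fun W _ => by
      rw [Finset.mem_powerset]; intro j hj; simp at hj ⊢; exact hj.2) _ hfib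
  rw [Finset.card_powerset, Finset.card_compl] at hall
  calc _ ≤ 2 * ((h + 1) * g.choose (g / 2)) * 2 ^ (Fintype.card ι - g) := by
        rw [mul_assoc]; exact Nat.mul_le_mul_left _ hall
    _ ≤ 2 ^ g * 2 ^ (Fintype.card ι - g) := Nat.mul_le_mul_right _ hslice
    _ = _ := by rw [← pow_add, Nat.add_sub_cancel' (Finset.card_le_univ G)]

/-! ### Points in general position -/

/-- Points on a parabola, scaled down: no three of them are aligned, and since they are finitely
many the triangle inequalities are strict with a uniform gap. -/
lemma exists_generalPosition {d : ℕ} (hd : 2 ≤ d) (k : ℕ) {r : ℝ} (hr : 0 < r) :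
    ∃ (q : Fin k → EuclideanSpace ℝ (Fin d)) (δ : ℝ), 0 < δ ∧ δ ≤ 1 ∧ (∀ i, ‖q i‖ ≤ r) ∧
      (∀ i j, i ≠ j → δ ≤ dist (q i) (q j)) ∧
      ∀ i j l, i ≠ j → j ≠ l → i ≠ l →
        δ ≤ dist (q i) (q j) + dist (q j) (q l) - dist (q i) (q l) := by
  let m : Fin k → EuclideanSpace ℝ (Fin d) := fun i =>
    WithLp.toLp 2 fun a => if a.1 = 0 then (i.1 : ℝ) else (i.1 : ℝ) ^ 2
  set c : ℝ := r / (1 + ∑ i, ‖m i‖) with hc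
  have hS : 0 ≤ ∑ i, ‖m i‖ := Finset.sum_nonneg fun _ _ => norm_nonneg _
  have hcpos : 0 < c := by positivity
  have h0 : ∀ i, m i ⟨0, by omega⟩ = (i.1 : ℝ) := fun i => by simp [m]
  have h1 : ∀ i, m i ⟨1, by omega⟩ = (i.1 : ℝ) ^ 2 := fun i => by simp [m]
  have hcast : ∀ i j : Fin k, i ≠ j → (i.1 : ℝ) ≠ j.1 := fun i j hij h =>
    hij (Fin.ext (by exact_mod_cast h))
  have hinj : ∀ i j, i ≠ j → 0 < dist (m i) (m j) := fun i j hij => by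
    rw [dist_pos]
    intro h
    exact hcast i j hij (by rw [← h0 i, ← h0 j, h])
  have hstr : ∀ i j l, i ≠ j → j ≠ l → i ≠ l →
      0 < dist (m i) (m j) + dist (m j) (m l) - dist (m i) (m l) := by
    intro i j l hij hjl hil
    rw [sub_pos]
    refine lt_of_le_of_ne (dist_triangle _ _ _) fun h => ?_
    obtain ⟨t, -, ht⟩ := dist_add_dist_eq_iff.1 h.symm
    have e0 := congrArg (fun v : EuclideanSpace ℝ (Fin d) => v ⟨0, by omega⟩) ht
    have e1 := congrArg (fun v : EuclideanSpace ℝ (Fin d) => v ⟨1, by omega⟩) ht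
    simp only [AffineMap.lineMap_apply, vsub_eq_sub, vadd_eq_add, PiLp.add_apply, PiLp.smul_apply,
      PiLp.sub_apply, smul_eq_mul, h0, h1] at e0 e1
    have : ((j.1 : ℝ) - i.1) * (j.1 - l.1) = 0 := by
      linear_combination ((l.1 : ℝ) + i.1) * e0 - e1
    rcases mul_eq_zero.1 this with h | h
    · exact hcast i j hij (by linarith)
    · exact hcast j l hjl (by linarith)
  have hfin : ∀ (S : Finset ℝ), (∀ a ∈ S, 0 < a) → ∃ δ > 0, ∀ a ∈ S, δ ≤ a := by
    intro S hSpos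
    rcases S.eq_empty_or_nonempty with rfl | hne
    · exact ⟨1, one_pos, by simp⟩
    · exact ⟨S.min' hne, hSpos _ (S.min'_mem hne), fun a ha => S.min'_le a ha⟩
  classical
  obtain ⟨δ₁, hδ₁, hm₁⟩ := hfin ((Finset.univ.filter fun p : Fin k × Fin k => p.1 ≠ p.2).image
    fun p => dist (m p.1) (m p.2)) (by
      simp only [Finset.mem_image, Finset.mem_filter, Finset.mem_univ, true_and]
      rintro _ ⟨p, hp, rfl⟩; exact hinj _ _ hp)
  obtain ⟨δ₂, hδ₂, hm₂⟩ := hfin ((Finset.univ.filter fun p : Fin k × Fin k × Fin k =>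
    p.1 ≠ p.2.1 ∧ p.2.1 ≠ p.2.2 ∧ p.1 ≠ p.2.2).image
    fun p => dist (m p.1) (m p.2.1) + dist (m p.2.1) (m p.2.2) - dist (m p.1) (m p.2.2)) (by
      simp only [Finset.mem_image, Finset.mem_filter, Finset.mem_univ, true_and]
      rintro _ ⟨p, hp, rfl⟩; exact hstr _ _ _ hp.1 hp.2.1 hp.2.2)
  have hds : ∀ i j, dist (c • m i) (c • m j) = c * dist (m i) (m j) := fun i j => by
    rw [dist_smul₀, Real.norm_of_nonneg hcpos.le]
  refine ⟨fun i => c • m i, min 1 (c * min δ₁ δ₂), by positivity, min_le_left _ _, fun i => ?_,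
    fun i j hij => ?_, fun i j l hij hjl hil => ?_⟩
  · rw [norm_smul, Real.norm_of_nonneg hcpos.le, hc, div_mul_eq_mul_div,
      div_le_iff₀ (by positivity)]
    have := Finset.single_le_sum (f := fun i => ‖m i‖) (fun _ _ => norm_nonneg _) (Finset.mem_univ i)
    exact mul_le_mul_of_nonneg_left (by linarith) hr.le
  · rw [hds]
    refine (min_le_right _ _).trans (mul_le_mul_of_nonneg_left ((min_le_left _ _).trans ?_) hcpos.le)
    exact hm₁ _ (Finset.mem_image.2 ⟨(i, j), by simpa using hij, rfl⟩)
  · rw [hds, hds, hds, ← mul_add, ← mul_sub]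
    refine (min_le_right _ _).trans (mul_le_mul_of_nonneg_left ((min_le_right _ _).trans ?_) hcpos.le)
    exact hm₂ _ (Finset.mem_image.2 ⟨(i, j, l), by simp [hij, hjl, hil], rfl⟩)

/-! ### A grid of balls in the unit cube -/

lemma abs_sub_apply_le_dist {d : ℕ} (x y : EuclideanSpace ℝ (Fin d)) (a : Fin d) :
    |x a - y a| ≤ dist x y := by
  rw [dist_eq_norm]
  simpa using PiLp.norm_apply_le (x - y) a

lemma exists_grid (d : ℕ) {M : ℕ} (hM : 0 < M) :
    ∃ c : (Fin d → Fin M) → EuclideanSpace ℝ (Fin d),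
      (∀ j, Metric.ball (c j) ((M : ℝ)⁻¹ / 2) ⊆ unitCube d) ∧
      ∀ i j, i ≠ j → (M : ℝ)⁻¹ ≤ dist (c i) (c j) := by
  have hM' : (0 : ℝ) < M := by exact_mod_cast hM
  refine ⟨fun j => WithLp.toLp 2 fun a => ((j a : ℝ) + 1 / 2) * (M : ℝ)⁻¹, fun j x hx a => ?_,
    fun i j hij => ?_⟩
  · rw [Metric.mem_ball] at hx
    have h := (abs_sub_apply_le_dist _ _ a).trans_lt hx
    simp only at h
    rw [abs_lt] at h
    have h1 : ((j a : ℝ) + 1) * (M : ℝ)⁻¹ ≤ 1 := by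
      rw [← div_eq_mul_inv, div_le_one hM']
      exact_mod_cast (j a).2
    have h2 : 0 ≤ (j a : ℝ) * (M : ℝ)⁻¹ := by positivity
    constructor <;> linarith
  · obtain ⟨a, ha⟩ := Function.ne_iff.1 hij
    refine le_trans ?_ (abs_sub_apply_le_dist _ _ a)
    simp only
    rw [← sub_mul, abs_mul, abs_of_pos (inv_pos.2 hM')]
    refine le_mul_of_one_le_left (inv_pos.2 hM').le ?_
    have : (1 : ℤ) ≤ |((i a : ℕ) : ℤ) - ((j a : ℕ) : ℤ)| :=
      Int.one_le_abs (sub_ne_zero.2 fun h => ha (Fin.ext (by exact_mod_cast h)))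
    rw [add_sub_add_right_eq_sub]
    exact_mod_cast this

/-! ### Swapping a set with a translate -/

section Swap

variable {E : Type*} [AddCommGroup E]

open Classical in
/-- The map exchanging `A` and its translate `A + u` (for `A` disjoint from `A + u`). -/
noncomputable def swapMap (A : Set E) (u : E) (y : E) : E :=
  if y ∈ A then y + u else if y - u ∈ A then y - u else y

lemma swapMap_of_mem {A : Set E} {u y : E} (h : y ∈ A) : swapMap A u y = y + u := by
  simp [swapMap, h]

lemma swapMap_of_notMem {A : Set E} {u y : E} (h : y ∉ A) (h' : y - u ∉ A) :
    swapMap A u y = y := by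
  simp [swapMap, h, h']

lemma swapMap_of_sub_mem {A : Set E} {u y : E} (h : y ∉ A) (h' : y - u ∈ A) :
    swapMap A u y = y - u := by
  simp [swapMap, h, h']

variable [MeasurableSpace E] [MeasurableAdd₂ E] [MeasurableSub₂ E]

lemma measurePreserving_swapMap (μ : Measure E) [μ.IsAddRightInvariant] {A : Set E} {u : E}
    (hA : MeasurableSet A) (hd : ∀ y ∈ A, y - u ∉ A) : MeasurePreserving (swapMap A u) μ μ := by
  have hA' : MeasurableSet {y | y - u ∈ A} := (measurable_id.sub_const u) hA
  have hm : Measurable (swapMap A u) :=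
    Measurable.ite hA (measurable_id.add_const u)
      (Measurable.ite hA' (measurable_id.sub_const u) measurable_id)
  refine ⟨hm, Measure.ext fun B hB => ?_⟩
  rw [Measure.map_apply hm hB]
  rw [← measure_inter_add_sdiff (swapMap A u ⁻¹' B) hA,
    ← measure_inter_add_sdiff (swapMap A u ⁻¹' B \ A) hA',
    ← measure_inter_add_sdiff B hA, ← measure_inter_add_sdiff (B \ A) hA']
  have e1 : swapMap A u ⁻¹' B ∩ A = (fun y => y + u) ⁻¹' ((B \ A) ∩ {y | y - u ∈ A}) := by
    ext y
    simp only [Set.mem_inter_iff, Set.mem_preimage, Set.mem_sdiff, Set.mem_ofPred_eq,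
      add_sub_cancel_right]
    refine ⟨fun h => ?_, fun h => ⟨?_, h.2⟩⟩
    · rw [swapMap_of_mem h.2] at h
      exact ⟨⟨h.1, fun h' => hd _ h' (by simpa using h.2)⟩, h.2⟩
    · rw [swapMap_of_mem h.2]; exact h.1.1
  have e2 : (swapMap A u ⁻¹' B \ A) ∩ {y | y - u ∈ A} = (fun y => y - u) ⁻¹' (B ∩ A) := by
    ext y
    simp only [Set.mem_inter_iff, Set.mem_preimage, Set.mem_sdiff, Set.mem_ofPred_eq]
    refine ⟨fun h => ?_, fun h => ?_⟩
    · rw [swapMap_of_sub_mem h.1.2 h.2] at h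
      exact ⟨h.1.1, h.2⟩
    · have hy : y ∉ A := fun h' => hd _ h' h.2
      rw [swapMap_of_sub_mem hy h.2]
      exact ⟨⟨h.1, hy⟩, h.2⟩
  have e3 : (swapMap A u ⁻¹' B \ A) \ {y | y - u ∈ A} = (B \ A) \ {y | y - u ∈ A} := by
    ext y
    simp only [Set.mem_preimage, Set.mem_sdiff, Set.mem_ofPred_eq]
    constructor
    · rintro ⟨⟨h1, h2⟩, h3⟩
      rw [swapMap_of_notMem h2 h3] at h1
      exact ⟨⟨h1, h2⟩, h3⟩
    · rintro ⟨⟨h1, h2⟩, h3⟩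
      rw [swapMap_of_notMem h2 h3]
      exact ⟨⟨h1, h2⟩, h3⟩
  rw [e1, e2, e3, measure_preimage_add_right]
  simp only [sub_eq_add_neg]
  rw [measure_preimage_add_right]
  simp only [← sub_eq_add_neg, ← add_assoc]
  rw [add_comm (μ ((B \ A) ∩ _))]

/-- The swap also preserves the uniform distribution on any set containing the swapped sets. -/
lemma measurePreserving_swapMap_cond (μ : Measure E) [μ.IsAddRightInvariant] {A C : Set E} {u : E}
    (hA : MeasurableSet A) (hC : MeasurableSet C) (hd : ∀ y ∈ A, y - u ∉ A)
    (hAC : ∀ y ∈ A, y ∈ C ∧ y + u ∈ C) :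
    MeasurePreserving (swapMap A u) (ProbabilityTheory.cond μ C) (ProbabilityTheory.cond μ C) := by
  have h := measurePreserving_swapMap μ hA hd
  have hpre : swapMap A u ⁻¹' C = C := by
    ext y
    rw [Set.mem_preimage]
    by_cases h1 : y ∈ A
    · rw [swapMap_of_mem h1]; exact iff_of_true (hAC y h1).2 (hAC y h1).1
    · by_cases h2 : y - u ∈ A
      · rw [swapMap_of_sub_mem h1 h2]
        exact iff_of_true (hAC _ h2).1 (by simpa using (hAC _ h2).2)
      · rw [swapMap_of_notMem h1 h2]
  have h' := h.restrict_preimage hC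
  rw [hpre] at h'
  exact h'.smul_measure _

end Swap

/-! ### The gadget: a cluster that can be moved next to fixed companions -/

/-- A local configuration at unit scale, made for moving a cluster in a ball of radius `1 / 2`
around the origin: `q` are the sites of a small cluster in general position, the cluster can be
moved by the vector `w`, and after the move each site has a companion site at the displacement `ζ`.
All sites are blurred to balls of radius `ρ`; the number `δ` bounds from below the gaps in the
triangle inequalities between three cluster sites. -/
structure Gadget (E : Type*) [NormedAddCommGroup E] (k : ℕ) where
  q : Fin k → E
  w : E
  ζ : E
  δ : ℝ
  ρ : ℝ
  δ_pos : 0 < δ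
  δ_le : δ ≤ 1
  ρ_eq : ρ = δ / (100 * (k + 1))
  norm_q_le : ∀ i, ‖q i‖ ≤ 1 / 40
  norm_w : ‖w‖ = 1 / 4
  norm_ζ : ‖ζ‖ = 4 * ρ
  le_dist : ∀ i j, i ≠ j → δ ≤ dist (q i) (q j)
  le_gap : ∀ i j l, i ≠ j → j ≠ l → i ≠ l →
    δ ≤ dist (q i) (q j) + dist (q j) (q l) - dist (q i) (q l)

lemma exists_gadget {d : ℕ} (hd : 2 ≤ d) (k : ℕ) :
    Nonempty (Gadget (EuclideanSpace ℝ (Fin d)) k) := by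
  obtain ⟨q, δ, hδ, hδ1, hq, hsep, hgap⟩ :=
    exists_generalPosition hd k (r := 1 / 40) (by norm_num)
  have : Nonempty (Fin d) := ⟨⟨0, by omega⟩⟩
  obtain ⟨w, hw⟩ := exists_norm_eq (EuclideanSpace ℝ (Fin d)) (c := 1 / 4) (by norm_num)
  obtain ⟨ζ, hζ⟩ := exists_norm_eq (EuclideanSpace ℝ (Fin d)) (c := 4 * (δ / (100 * (k + 1))))
    (by positivity)
  exact ⟨⟨q, w, ζ, δ, _, hδ, hδ1, rfl, hq, hw, hζ, hsep, hgap⟩⟩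

lemma eq_of_mem_balls {E ι : Type*} [NormedAddCommGroup E] {s : ℝ} {c : ι → E}
    (hc : ∀ i j, i ≠ j → s ≤ dist (c i) (c j)) {i j : ι} {y : E}
    (hi : y ∈ Metric.ball (c i) (s / 2)) (hj : y ∈ Metric.ball (c j) (s / 2)) : i = j := by
  by_contra h
  rw [Metric.mem_ball] at hi hj
  linarith [hc i j h, dist_triangle_left (c i) (c j) y]

namespace Gadget

variable {E : Type*} [NormedAddCommGroup E] {k : ℕ} (g : Gadget E k)

lemma ρ_pos : 0 < g.ρ := by
  rw [g.ρ_eq]; have := g.δ_pos; positivity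

lemma mul_ρ_eq : 100 * (k + 1) * g.ρ = g.δ := by
  rw [g.ρ_eq]; field_simp

lemma hundred_mul_ρ_le : 100 * g.ρ ≤ g.δ := by
  rw [← g.mul_ρ_eq]
  have : 0 ≤ (k : ℝ) * g.ρ := mul_nonneg k.cast_nonneg g.ρ_pos.le
  linarith

/-- The cluster sites and their companions. -/
def site : Fin k ⊕ Fin k → E
  | .inl i => g.q i
  | .inr i => g.q i + g.w + g.ζ

variable [NormedSpace ℝ E]

/-- The blurred sites, for a gadget of scale `s` centred at `c`. -/
def region (c : E) (s : ℝ) (t : Fin k ⊕ Fin k) : Set E :=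
  Metric.ball (c + s • g.site t) (s * g.ρ)

/-- The cluster part of a gadget of scale `s` centred at `c`. -/
def core (c : E) (s : ℝ) : Set E := ⋃ i, g.region c s (.inl i)

/-- The union of the cluster parts of the gadgets centred at `c j`, `j ∈ W`. -/
def cores {ι : Type*} (c : ι → E) (s : ℝ) (W : Finset ι) : Set E := ⋃ j ∈ W, g.core (c j) s

/-- The configuration `x` occupies the gadget of scale `s` centred at `c` if every blurred site
holds exactly one point of `x` and there is no further point in the ball of radius `s / 2`. -/
def IsOn {α : Type*} (c : E) (s : ℝ) (x : α → E) : Prop :=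
  ∃ a : (Fin k ⊕ Fin k) ↪ α, (∀ t, x (a t) ∈ g.region c s t) ∧
    ∀ b, b ∉ Set.range a → x b ∉ Metric.ball c (s / 2)

variable {c : E} {s : ℝ}

lemma dist_le_of_mem_core (hs : 0 < s) {y : E} (hy : y ∈ g.core c s) :
    dist y c ≤ s * (3 / 100) := by
  obtain ⟨i, hi⟩ := Set.mem_iUnion.1 hy
  rw [region, Metric.mem_ball] at hi
  have h1 := dist_triangle y (c + s • g.site (.inl i)) c
  rw [dist_eq_norm (c + _), add_sub_cancel_left, norm_smul, Real.norm_of_nonneg hs.le] at h1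
  have h2 : s * ‖g.site (.inl i)‖ ≤ s * (1 / 40) :=
    mul_le_mul_of_nonneg_left (g.norm_q_le i) hs.le
  have h3 : 2 * (s * g.ρ) ≤ s * (1 / 100) := by
    have := g.mul_ρ_eq
    have hk : (1 : ℝ) ≤ k := by exact_mod_cast i.pos
    have : 200 * g.ρ ≤ 1 := by nlinarith [g.ρ_pos, g.δ_le]
    nlinarith
  linarith

lemma add_mem_ball_of_mem_core (hs : 0 < s) {y : E} (hy : y ∈ g.core c s) :
    y + s • g.w ∈ Metric.ball c (s / 2) := by
  rw [Metric.mem_ball, dist_eq_norm, add_sub_right_comm]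
  refine (norm_add_le _ _).trans_lt ?_
  rw [← dist_eq_norm, norm_smul, g.norm_w, Real.norm_of_nonneg hs.le]
  linarith [g.dist_le_of_mem_core hs hy]

lemma mem_ball_of_mem_core (hs : 0 < s) {y : E} (hy : y ∈ g.core c s) :
    y ∈ Metric.ball c (s / 2) := by
  rw [Metric.mem_ball]; linarith [g.dist_le_of_mem_core hs hy]

lemma dist_of_mem_region_inr (hs : 0 < s) {y : E} {i : Fin k} (hy : y ∈ g.region c s (.inr i)) :
    s * (1 / 5) ≤ dist y c ∧ dist y c < s / 2 := by
  rw [region, Metric.mem_ball] at hy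
  have hk : (1 : ℝ) ≤ k := by exact_mod_cast i.pos
  have hρ : 200 * g.ρ ≤ 1 := by nlinarith [g.ρ_pos, g.δ_le, g.mul_ρ_eq]
  have hv : dist (c + s • g.site (.inr i)) c = s * ‖g.site (.inr i)‖ := by
    rw [dist_eq_norm, add_sub_cancel_left, norm_smul, Real.norm_of_nonneg hs.le]
  have h1 : ‖g.site (.inr i)‖ ≤ 1 / 40 + 1 / 4 + 4 * g.ρ := by
    refine norm_add₃_le.trans ?_
    rw [g.norm_w, g.norm_ζ]; linarith [g.norm_q_le i]
  have h2 : 1 / 4 - 1 / 40 - 4 * g.ρ ≤ ‖g.site (.inr i)‖ := by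
    have : g.w = g.site (.inr i) - g.q i - g.ζ := by simp only [site]; abel
    have h := (congrArg norm this).le.trans ((norm_sub_le _ _).trans
      (add_le_add_left (norm_sub_le _ _) _))
    rw [g.norm_w, g.norm_ζ] at h; linarith [g.norm_q_le i]
  have h3 := dist_triangle y (c + s • g.site (.inr i)) c
  have h4 := dist_triangle_left (c + s • g.site (.inr i)) c y
  rw [hv] at h3 h4
  constructor <;> nlinarith

lemma region_subset_ball (hs : 0 < s) (t : Fin k ⊕ Fin k) :
    g.region c s t ⊆ Metric.ball c (s / 2) := by
  intro y hy
  cases t with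
  | inl i => exact g.mem_ball_of_mem_core hs (Set.mem_iUnion.2 ⟨i, hy⟩)
  | inr i => exact (g.dist_of_mem_region_inr hs hy).2

lemma notMem_core_of_mem_region_inr (hs : 0 < s) {y : E} {i : Fin k}
    (hy : y ∈ g.region c s (.inr i)) : y ∉ g.core c s := fun h => by
  linarith [g.dist_le_of_mem_core hs h, (g.dist_of_mem_region_inr hs hy).1]

lemma smul_dist_lt_of_mem_balls (hs : 0 < s) {y u v : E} (hu : y ∈ Metric.ball (c + s • u) (s * g.ρ))
    (hv : y ∈ Metric.ball (c + s • v) (s * g.ρ)) : dist u v < 2 * g.ρ := by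
  rw [Metric.mem_ball] at hu hv
  have h := dist_triangle_left (c + s • u) (c + s • v) y
  rw [dist_add_left, dist_smul₀, Real.norm_of_nonneg hs.le] at h
  have : s * dist u v < s * (2 * g.ρ) := by linarith
  exact lt_of_mul_lt_mul_left this hs.le

lemma disjoint_region (hs : 0 < s) {t t' : Fin k ⊕ Fin k} (htt : t ≠ t') :
    Disjoint (g.region c s t) (g.region c s t') := by
  rw [Set.disjoint_left]
  intro y hy hy'
  have h := g.smul_dist_lt_of_mem_balls hs hy hy'
  have hρ := g.ρ_pos
  have hρδ := g.hundred_mul_ρ_le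
  cases t with
  | inl i =>
    cases t' with
    | inl j =>
      have := g.le_dist i j fun h => htt (by rw [h])
      simp only [site] at h; linarith
    | inr j => exact g.notMem_core_of_mem_region_inr hs hy' (Set.mem_iUnion.2 ⟨i, hy⟩)
  | inr i =>
    cases t' with
    | inl j => exact g.notMem_core_of_mem_region_inr hs hy (Set.mem_iUnion.2 ⟨j, hy'⟩)
    | inr j =>
      have := g.le_dist i j fun h => htt (by rw [h])
      simp only [site, dist_add_right] at h; linarith

/-- The companions are not hit by the moved cluster. -/
lemma sub_notMem_core_of_mem_region_inr (hs : 0 < s) {y : E} {i : Fin k}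
    (hy : y ∈ g.region c s (.inr i)) : y - s • g.w ∉ g.core c s := by
  intro h
  obtain ⟨l, hl⟩ := Set.mem_iUnion.1 h
  have hy' : y - s • g.w ∈ Metric.ball (c + s • (g.q i + g.ζ)) (s * g.ρ) := by
    rw [region, Metric.mem_ball, dist_eq_norm] at hy
    rw [Metric.mem_ball, dist_eq_norm]
    convert hy using 2
    simp only [site, smul_add]; abel
  have h := g.smul_dist_lt_of_mem_balls hs hy' hl
  simp only [site] at h
  have hρ := g.ρ_pos
  by_cases hil : i = l
  · subst hil
    rw [dist_eq_norm, add_sub_cancel_left, g.norm_ζ] at h; linarith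
  · have h1 := g.le_dist i l hil
    have h2 := dist_triangle (g.q i) (g.q i + g.ζ) (g.q l)
    rw [dist_self_add_right, g.norm_ζ] at h2
    linarith [g.hundred_mul_ρ_le]

section Many

variable {ι : Type*} {c : ι → E}

lemma mem_cores {W : Finset ι} {y : E} : y ∈ g.cores c s W ↔ ∃ j ∈ W, y ∈ g.core (c j) s := by
  simp [cores]

lemma sub_notMem_cores (hs : 0 < s) (hc : ∀ i j, i ≠ j → s ≤ dist (c i) (c j))
    {W : Finset ι} {y : E} (hy : y ∈ g.cores c s W) :
    y - s • g.w ∉ g.cores c s W := by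
  intro h
  obtain ⟨i, -, hi⟩ := g.mem_cores.1 hy
  obtain ⟨j, -, hj⟩ := g.mem_cores.1 h
  have h1 := g.add_mem_ball_of_mem_core hs hj
  rw [sub_add_cancel] at h1
  obtain rfl := eq_of_mem_balls hc (g.mem_ball_of_mem_core hs hi) h1
  have h2 := dist_triangle_right y (y - s • g.w) (c i)
  rw [dist_self_sub_right, norm_smul, g.norm_w, Real.norm_of_nonneg hs.le] at h2
  linarith [g.dist_le_of_mem_core hs hi, g.dist_le_of_mem_core hs hj]

lemma mem_core_of_mem_cores (hs : 0 < s) (hc : ∀ i j, i ≠ j → s ≤ dist (c i) (c j))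
    {W : Finset ι} {j : ι} {y : E} (hy : y ∈ Metric.ball (c j) (s / 2))
    (h : y ∈ g.cores c s W) : j ∈ W ∧ y ∈ g.core (c j) s := by
  obtain ⟨i, hiW, hi⟩ := g.mem_cores.1 h
  obtain rfl := eq_of_mem_balls hc hy (g.mem_ball_of_mem_core hs hi)
  exact ⟨hiW, hi⟩

lemma sub_mem_core_of_mem_cores (hs : 0 < s) (hc : ∀ i j, i ≠ j → s ≤ dist (c i) (c j))
    {W : Finset ι} {j : ι} {y : E}
    (hy : y ∈ Metric.ball (c j) (s / 2)) (h : y - s • g.w ∈ g.cores c s W) :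
    j ∈ W ∧ y - s • g.w ∈ g.core (c j) s := by
  obtain ⟨i, hiW, hi⟩ := g.mem_cores.1 h
  have h1 := g.add_mem_ball_of_mem_core hs hi
  rw [sub_add_cancel] at h1
  obtain rfl := eq_of_mem_balls hc hy h1
  exact ⟨hiW, hi⟩

lemma swap_eq_self (hs : 0 < s) (hc : ∀ i j, i ≠ j → s ≤ dist (c i) (c j))
    {W : Finset ι} {j : ι} (hj : j ∉ W) {y : E}
    (hy : y ∈ Metric.ball (c j) (s / 2)) : swapMap (g.cores c s W) (s • g.w) y = y :=
  swapMap_of_notMem (fun h => hj (g.mem_core_of_mem_cores hs hc hy h).1)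
    (fun h => hj (g.sub_mem_core_of_mem_cores hs hc hy h).1)

lemma swap_notMem_ball (hs : 0 < s) (hc : ∀ i j, i ≠ j → s ≤ dist (c i) (c j))
    (W : Finset ι) {j : ι} {y : E} (hy : y ∉ Metric.ball (c j) (s / 2)) :
    swapMap (g.cores c s W) (s • g.w) y ∉ Metric.ball (c j) (s / 2) := by
  by_cases h1 : y ∈ g.cores c s W
  · rw [swapMap_of_mem h1]
    intro h
    obtain ⟨i, -, hi⟩ := g.mem_cores.1 h1
    obtain rfl := eq_of_mem_balls hc (g.add_mem_ball_of_mem_core hs hi) h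
    exact hy (g.mem_ball_of_mem_core hs hi)
  · by_cases h2 : y - s • g.w ∈ g.cores c s W
    · rw [swapMap_of_sub_mem h1 h2]
      intro h
      obtain ⟨i, -, hi⟩ := g.mem_cores.1 h2
      obtain rfl := eq_of_mem_balls hc (g.mem_ball_of_mem_core hs hi) h
      exact hy (by simpa using g.add_mem_ball_of_mem_core hs hi)
    · rwa [swapMap_of_notMem h1 h2]

lemma swap_insert_eq (hs : 0 < s) [DecidableEq ι] (W : Finset ι) {j : ι} {y : E}
    (hy : y ∉ Metric.ball (c j) (s / 2)) :
    swapMap (g.cores c s (insert j W)) (s • g.w) y = swapMap (g.cores c s W) (s • g.w) y := by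
  have h1 : y ∈ g.cores c s (insert j W) ↔ y ∈ g.cores c s W := by
    simp only [mem_cores, Finset.exists_mem_insert, or_iff_right_iff_imp]
    exact fun h => absurd (g.mem_ball_of_mem_core hs h) hy
  have h2 : y - s • g.w ∈ g.cores c s (insert j W) ↔ y - s • g.w ∈ g.cores c s W := by
    simp only [mem_cores, Finset.exists_mem_insert, or_iff_right_iff_imp]
    exact fun h => absurd (by simpa using g.add_mem_ball_of_mem_core hs h) hy
  unfold swapMap
  split_ifs <;> tauto

lemma swap_companion (hs : 0 < s) (hc : ∀ i j, i ≠ j → s ≤ dist (c i) (c j))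
    (W : Finset ι) {j : ι} {y : E} {i : Fin k}
    (hy : y ∈ g.region (c j) s (.inr i)) : swapMap (g.cores c s W) (s • g.w) y = y :=
  have hb := g.region_subset_ball hs _ hy
  swapMap_of_notMem
    (fun h => g.notMem_core_of_mem_region_inr hs hy (g.mem_core_of_mem_cores hs hc hb h).2)
    (fun h => g.sub_notMem_core_of_mem_region_inr hs hy (g.sub_mem_core_of_mem_cores hs hc hb h).2)

end Many

end Gadget

/-! ### The effect of moving a cluster -/

namespace Gadget

variable {E : Type*} [NormedAddCommGroup E] [NormedSpace ℝ E] {k : ℕ} (g : Gadget E k)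

/-- Blurring the cluster sites costs little of the gaps in the triangle inequalities. -/
lemma gap_of_mem_regions {c : E} {s : ℝ} (hs : 0 < s) {i j l : Fin k} (hij : i ≠ j) (hjl : j ≠ l)
    (hil : i ≠ l) {x y z : E} (hx : x ∈ g.region c s (.inl i)) (hy : y ∈ g.region c s (.inl j))
    (hz : z ∈ g.region c s (.inl l)) :
    s * (g.δ - 6 * g.ρ) ≤ dist x y + dist y z - dist x z := by
  simp only [region, site, Metric.mem_ball] at hx hy hz
  have key : ∀ a b, dist (c + s • g.q a) (c + s • g.q b) = s * dist (g.q a) (g.q b) := fun a b => by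
    rw [dist_add_left, dist_smul₀, Real.norm_of_nonneg hs.le]
  have h := mul_le_mul_of_nonneg_left (g.le_gap i j l hij hjl hil) hs.le
  have h1 := dist_triangle4 (c + s • g.q i) x y (c + s • g.q j)
  have h2 := dist_triangle4 (c + s • g.q j) y z (c + s • g.q l)
  have h3 := dist_triangle4 x (c + s • g.q i) (c + s • g.q l) z
  rw [key, dist_comm _ x] at h1
  rw [key, dist_comm _ y] at h2
  rw [key, dist_comm (c + s • g.q l) z] at h3
  rw [mul_sub, mul_add] at h
  rw [mul_sub]
  linarith

/-- Moving the cluster of an occupied gadget next to its companions shortens the optimal tour by a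
definite amount, whatever has been done to the other gadgets: in the cluster position the points
cost at least `s * (δ - 6 ρ)`, next to the companions at most `12 k s ρ`. -/
lemma tsp_swap_insert_add_le {T : Finset E}
    (hT : ∀ u : E, ‖u‖ = 1 → ∃ c ∈ T, dist u c < 1 / 4) (hk : 2 * T.card < k) (hk3 : 3 ≤ k)
    {ι : Type*} [DecidableEq ι] {c : ι → E} {s : ℝ} (hs : 0 < s)
    (hc : ∀ i j, i ≠ j → s ≤ dist (c i) (c j)) {α : Type*} [Fintype α] [DecidableEq α] {x : α → E}
    {j : ι} (hx : g.IsOn (c j) s x) {W : Finset ι} (hj : j ∉ W) :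
    tsp (fun i => swapMap (g.cores c s (insert j W)) (s • g.w) (x i)) Finset.univ + s * (g.δ / 2) ≤
      tsp (fun i => swapMap (g.cores c s W) (s • g.w) (x i)) Finset.univ := by
  obtain ⟨a, ha, hb⟩ := hx
  set y : α → E := fun i => swapMap (g.cores c s W) (s • g.w) (x i) with hy
  set y' : α → E := fun i => swapMap (g.cores c s (insert j W)) (s • g.w) (x i) with hy'
  set Z : Finset α := Finset.univ.image fun i => a (.inl i) with hZ
  have hinl : ∀ i, a (.inl i) ∈ Z := fun i => Finset.mem_image_of_mem _ (Finset.mem_univ i)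
  have hinr : ∀ i, a (.inr i) ∉ Z := fun i h => by
    obtain ⟨i', -, h⟩ := Finset.mem_image.1 h
    exact absurd (a.injective h) (by simp)
  have hZcard : Z.card = k := by
    rw [hZ, Finset.card_image_of_injective _ fun _ _ h => Sum.inl_injective (a.injective h),
      Finset.card_univ, Fintype.card_fin]
  have hyl : ∀ i, y (a (.inl i)) = x (a (.inl i)) := fun i =>
    g.swap_eq_self hs hc hj (g.region_subset_ball hs _ (ha _))
  have hyl' : ∀ i, y' (a (.inl i)) = x (a (.inl i)) + s • g.w := fun i =>
    swapMap_of_mem (g.mem_cores.2 ⟨j, by simp, Set.mem_iUnion.2 ⟨i, ha _⟩⟩)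
  have hyr : ∀ i, y (a (.inr i)) = x (a (.inr i)) := fun i => g.swap_companion hs hc W (ha _)
  have hyr' : ∀ i, y' (a (.inr i)) = x (a (.inr i)) := fun i => g.swap_companion hs hc _ (ha _)
  have hcases : ∀ b, b ∈ Finset.univ \ Z → (∃ i, b = a (.inr i)) ∨ x b ∉ Metric.ball (c j) (s / 2) := by
    intro b hbZ
    by_cases h : b ∈ Set.range a
    · obtain ⟨t | t, rfl⟩ := h
      · simp [hinl t] at hbZ
      · exact Or.inl ⟨t, rfl⟩
    · exact Or.inr (hb b h)
  have hsame : tsp y' (Finset.univ \ Z) = tsp y (Finset.univ \ Z) := tsp_congr fun b hbZ => by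
    rcases hcases b hbZ with ⟨i, rfl⟩ | h
    · rw [hyr, hyr']
    · exact g.swap_insert_eq hs W h
  have hlow : tsp y (Finset.univ \ Z) + s * (g.δ - 6 * g.ρ) ≤ tsp y Finset.univ := by
    refine tsp_sdiff_add_le hT (Finset.subset_univ Z) (e := c j) (r := s * (3 / 100))
      (R := s * (1 / 5)) ?_ ?_ (by linarith) (by rwa [hZcard]) (by rwa [hZcard]) ?_
    · intro z hz
      obtain ⟨i, -, rfl⟩ := Finset.mem_image.1 hz
      rw [hyl]
      exact g.dist_le_of_mem_core hs (Set.mem_iUnion.2 ⟨i, ha _⟩)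
    · intro b hbZ
      rcases hcases b hbZ with ⟨i, rfl⟩ | h
      · rw [hyr]; exact (g.dist_of_mem_region_inr hs (ha _)).1
      · have := g.swap_notMem_ball hs hc W h
        rw [Metric.mem_ball, not_lt] at this
        exact le_trans (by linarith) this
    · intro p hp z hz q hq hpz hzq hpq
      obtain ⟨i₁, -, rfl⟩ := Finset.mem_image.1 hp
      obtain ⟨i₂, -, rfl⟩ := Finset.mem_image.1 hz
      obtain ⟨i₃, -, rfl⟩ := Finset.mem_image.1 hq
      rw [hyl, hyl, hyl]
      exact g.gap_of_mem_regions hs (fun h => hpz (by rw [h])) (fun h => hzq (by rw [h]))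
        (fun h => hpq (by rw [h])) (ha _) (ha _) (ha _)
  have hup : tsp y' Finset.univ ≤ tsp y' (Finset.univ \ Z) + k * (2 * (s * (6 * g.ρ))) := by
    have h := tsp_union_le y' (s := Finset.univ \ Z) (Z := Z) Finset.sdiff_disjoint
      (η := s * (6 * g.ρ)) (by
        intro z hz
        obtain ⟨i, -, rfl⟩ := Finset.mem_image.1 hz
        refine ⟨a (.inr i), by simp [hinr i], ?_⟩
        rw [hyl', hyr']
        have h1 := ha (.inl i)
        have h2 := ha (.inr i)
        simp only [region, Metric.mem_ball, site] at h1 h2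
        have h3 := dist_triangle4 (x (a (.inl i)) + s • g.w) (c j + s • g.q i + s • g.w)
          (c j + s • (g.q i + g.w + g.ζ)) (x (a (.inr i)))
        rw [dist_add_right, dist_comm (c j + _) (x (a (.inr i)))] at h3
        have h4 : dist (c j + s • g.q i + s • g.w) (c j + s • (g.q i + g.w + g.ζ)) =
            s * (4 * g.ρ) := by
          rw [smul_add, smul_add, ← add_assoc, ← add_assoc, dist_self_add_right, norm_smul,
            g.norm_ζ, Real.norm_of_nonneg hs.le]
        linarith)
    rwa [Finset.sdiff_union_of_subset (Finset.subset_univ Z), hZcard] at h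
  rw [hsame] at hup
  have hρ := g.ρ_pos
  have hkρ : 0 ≤ (k : ℝ) * g.ρ := by positivity
  have hfin : g.δ / 2 + k * (2 * (6 * g.ρ)) ≤ g.δ - 6 * g.ρ := by
    have := g.mul_ρ_eq
    nlinarith
  have := mul_le_mul_of_nonneg_left hfin hs.le
  linarith

end Gadget

/-! ### Averaging over the moves -/

/-- If a family of measure-preserving maps `T W`, indexed by sets of moves, is such that a move `j`
lowers `L` by at least `ε` at the points of `On j`, and if the sets `On j` have measure at least
`p`, then `L` is not concentrated on an interval that is short compared with `ε` times the square
root of the number of moves. -/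
lemma measureReal_Icc_le_of_moves {X ι : Type*} [MeasurableSpace X] {μ : Measure X}
    [IsProbabilityMeasure μ] [Fintype ι] [DecidableEq ι] {T : Finset ι → X → X}
    (hT : ∀ W, MeasurePreserving (T W) μ μ) {L : X → ℝ} (hL : Measurable L) {On : ι → Set X}
    (hOn : ∀ j, MeasurableSet (On j)) {p ε : ℝ} (hε : 0 < ε) (hp : ∀ j, p ≤ μ.real (On j))
    (hdrop : ∀ j, ∀ x ∈ On j, ∀ W, j ∉ W → L (T (insert j W) x) + ε ≤ L (T W x))
    (hcard : 64 ≤ Fintype.card ι * (p / 2)) {a b : ℝ}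
    (hab : b - a ≤ ε * (√(Fintype.card ι * (p / 2)) / 8)) :
    μ.real {x | a ≤ L x ∧ L x ≤ b} ≤ 1 - p / 4 := by
  classical
  set m := Fintype.card ι with hm
  set S : Set X := {x | a ≤ L x ∧ L x ≤ b} with hS
  have hSm : MeasurableSet S := hL measurableSet_Icc
  have hm0 : (0 : ℝ) < m := by
    rcases m.eq_zero_or_pos with h | h
    · rw [h] at hcard; norm_num at hcard
    · exact_mod_cast h
  have hp0 : 0 < p := by
    by_contra h
    have := mul_nonneg hm0.le (show 0 ≤ -(p / 2) by linarith)
    linarith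
  have hpt : ∀ x, ∑ W, (T W ⁻¹' S).indicator (1 : X → ℝ) x ≤
      2 ^ m * (1 - 1 / 2 * ((∑ j, (On j).indicator (1 : X → ℝ) x) / m - p / 2)) := by
    intro x
    set G : Finset ι := Finset.univ.filter fun j => x ∈ On j with hG
    have e1 : ∑ W, (T W ⁻¹' S).indicator (1 : X → ℝ) x =
        ((Finset.univ.filter fun W => L (T W x) ∈ Set.Icc a b).card : ℝ) := by
      simp [Set.indicator_apply, hS]
    have e2 : ∑ j, (On j).indicator (1 : X → ℝ) x = (G.card : ℝ) := by
      simp [Set.indicator_apply, hG]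
    rw [e1, e2]
    have hGm : (G.card : ℝ) / m ≤ 1 := by
      rw [div_le_one hm0]; exact_mod_cast Finset.card_le_univ G
    have h2m : (0 : ℝ) < 2 ^ m := by positivity
    by_cases hbig : m * (p / 2) ≤ (G.card : ℝ)
    · have h := two_mul_card_filter_mem_Icc_le (fun W => L (T W x)) G hε
        (fun j hj W hW => hdrop j x (by simpa [hG] using hj) W hW)
        (by exact_mod_cast hcard.trans hbig) (a := a) (b := b) (hab.trans (by gcongr))
      have h' : (2 : ℝ) * ((Finset.univ.filter fun W => L (T W x) ∈ Set.Icc a b).card : ℝ) ≤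
          2 ^ m := by exact_mod_cast h
      nlinarith
    · have h : ((Finset.univ.filter fun W => L (T W x) ∈ Set.Icc a b).card : ℝ) ≤ 2 ^ m := by
        have := Finset.card_le_univ (Finset.univ.filter fun W => L (T W x) ∈ Set.Icc a b)
        rw [Fintype.card_finset] at this
        exact_mod_cast this
      have h3 : (G.card : ℝ) / m ≤ p / 2 := by
        rw [div_le_iff₀ hm0]; linarith
      nlinarith
  have hIS : ∀ W, Integrable ((T W ⁻¹' S).indicator (1 : X → ℝ)) μ := fun W =>
    (integrable_const (1 : ℝ)).indicator ((hT W).measurable hSm)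
  have hIOn : ∀ j, Integrable ((On j).indicator (1 : X → ℝ)) μ := fun j =>
    (integrable_const (1 : ℝ)).indicator (hOn j)
  have hsum : Integrable (fun x => ∑ j, (On j).indicator (1 : X → ℝ) x) μ :=
    integrable_finsetSum _ fun j _ => hIOn j
  have hI₁ : Integrable (fun x => (∑ j, (On j).indicator (1 : X → ℝ) x) / m - p / 2) μ :=
    (hsum.div_const _).sub (integrable_const _)
  have hI₂ : Integrable (fun x =>
      (1 : ℝ) - 1 / 2 * ((∑ j, (On j).indicator (1 : X → ℝ) x) / m - p / 2)) μ :=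
    (integrable_const _).sub (hI₁.const_mul _)
  have hint := integral_mono (integrable_finsetSum _ fun W _ => hIS W) (hI₂.const_mul _) hpt
  rw [integral_finsetSum _ fun W _ => hIS W] at hint
  simp only [integral_indicator_one ((hT _).measurable hSm)] at hint
  rw [integral_const_mul, integral_sub (integrable_const _) (hI₁.const_mul _),
    integral_const_mul, integral_sub (hsum.div_const _) (integrable_const _), integral_div,
    integral_finsetSum _ fun j _ => hIOn j] at hint
  simp only [integral_indicator_one (hOn _), integral_const, probReal_univ, one_smul,
    (hT _).measureReal_preimage hSm.nullMeasurableSet, Finset.sum_const, Finset.card_univ,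
    Fintype.card_finset, nsmul_eq_mul] at hint
  have hpm : p ≤ (∑ j, μ.real (On j)) / m := by
    rw [le_div_iff₀ hm0, mul_comm]
    have := Finset.card_nsmul_le_sum Finset.univ (fun j => μ.real (On j)) p fun j _ => hp j
    rwa [Finset.card_univ, nsmul_eq_mul] at this
  rw [← hm] at hint
  push_cast at hint
  have h2m : (0 : ℝ) < 2 ^ m := by positivity
  have := le_of_mul_le_mul_left hint h2m
  linarith

/-! ### The probability that a gadget is occupied -/

/-- The probability that, of `n` independent points with law `ν`, exactly one lies in each of the
disjoint sets `R t ⊆ B` of equal measure and no other point lies in `B`. -/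
lemma measureReal_pi_exists_embedding {E τ : Type*} [MeasurableSpace E] (ν : Measure E)
    [IsProbabilityMeasure ν] [Fintype τ] [DecidableEq τ] {R : τ → Set E} {B : Set E} {p : ℝ} (n : ℕ)
    (hR : ∀ t, MeasurableSet (R t)) (hB : MeasurableSet B) (hRB : ∀ t, R t ⊆ B)
    (hdisj : Pairwise fun t t' => Disjoint (R t) (R t')) (hp : ∀ t, ν.real (R t) = p) :
    MeasurableSet {x : Fin n → E | ∃ a : τ ↪ Fin n, (∀ t, x (a t) ∈ R t) ∧
      ∀ b, b ∉ Set.range a → x b ∉ B} ∧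
    (Measure.pi fun _ : Fin n => ν).real {x : Fin n → E | ∃ a : τ ↪ Fin n, (∀ t, x (a t) ∈ R t) ∧
      ∀ b, b ∉ Set.range a → x b ∉ B} =
      n.descFactorial (Fintype.card τ) *
        (p ^ Fintype.card τ * (1 - ν.real B) ^ (n - Fintype.card τ)) := by
  classical
  have hset : ∀ (a : τ ↪ Fin n), ∃ D : Fin n → Set E, (∀ t, D (a t) = R t) ∧
      (∀ b, b ∉ Set.range a → D b = Bᶜ) := by
    intro a
    refine ⟨fun b => if h : ∃ t, a t = b then R h.choose else Bᶜ, fun t => ?_, fun b hb => ?_⟩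
    · have h : ∃ t', a t' = a t := ⟨t, rfl⟩
      simp only [h, dif_pos]
      rw [a.injective h.choose_spec]
    · have h : ¬ ∃ t, a t = b := hb
      simp only [h, dif_neg, not_false_eq_true]
  choose D hD hD' using hset
  have hDm : ∀ a b, MeasurableSet (D a b) := fun a b => by
    by_cases h : b ∈ Set.range a
    · obtain ⟨t, rfl⟩ := h; rw [hD]; exact hR t
    · rw [hD' a b h]; exact hB.compl
  have heq : {x : Fin n → E | ∃ a : τ ↪ Fin n, (∀ t, x (a t) ∈ R t) ∧
      ∀ b, b ∉ Set.range a → x b ∉ B} = ⋃ a : τ ↪ Fin n, Set.univ.pi (D a) := by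
    ext x
    simp only [Set.mem_ofPred_eq, Set.mem_iUnion, Set.mem_univ_pi]
    refine exists_congr fun a => ⟨fun h b => ?_, fun h => ⟨fun t => ?_, fun b hb => ?_⟩⟩
    · by_cases hb : b ∈ Set.range a
      · obtain ⟨t, rfl⟩ := hb; rw [hD]; exact h.1 t
      · rw [hD' a b hb]; exact h.2 b hb
    · rw [← hD a t]; exact h _
    · have := h b; rw [hD' a b hb] at this; exact this
  have hpm : ∀ a, MeasurableSet (Set.univ.pi (D a)) := fun a =>
    MeasurableSet.univ_pi fun b => hDm a b
  have hd : Pairwise (Function.onFun Disjoint fun a : τ ↪ Fin n => Set.univ.pi (D a)) := by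
    intro a a' haa
    rw [Function.onFun, Set.disjoint_left]
    intro x hx hx'
    rw [Set.mem_univ_pi] at hx hx'
    refine haa (Function.Embedding.ext fun t => ?_)
    have h1 : x (a t) ∈ R t := by rw [← hD a t]; exact hx _
    by_cases hr : a t ∈ Set.range a'
    · obtain ⟨t', ht'⟩ := hr
      have h2 : x (a t) ∈ R t' := by rw [← hD a' t', ← ht']; exact hx' _
      have : t = t' := by
        by_contra hne
        exact Set.disjoint_left.1 (hdisj hne) h1 h2
      subst this
      exact ht'.symm
    · have := hx' (a t)
      rw [hD' a' _ hr] at this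
      exact absurd (hRB t h1) this
  refine ⟨heq ▸ MeasurableSet.iUnion hpm, ?_⟩
  rw [heq, measureReal_iUnion_fintype hd hpm]
  have hone : ∀ a : τ ↪ Fin n, (Measure.pi fun _ : Fin n => ν).real (Set.univ.pi (D a)) =
      p ^ Fintype.card τ * (1 - ν.real B) ^ (n - Fintype.card τ) := by
    intro a
    rw [Measure.real, Measure.pi_pi, ENNReal.toReal_prod]
    rw [← Finset.prod_mul_prod_compl (Finset.univ.map a)]
    congr 1
    · rw [Finset.prod_map]
      calc _ = ∏ _t : τ, p := Finset.prod_congr rfl fun t _ => by rw [hD, ← hp t]; rfl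
        _ = _ := by simp
    · calc _ = ∏ _b ∈ (Finset.univ.map a)ᶜ, (1 - ν.real B) := by
            refine Finset.prod_congr rfl fun b hb => ?_
            rw [hD' a b (by simpa using hb), ← probReal_compl_eq_one_sub hB]; rfl
        _ = _ := by simp [Finset.card_compl]
  simp only [hone, Finset.sum_const, Finset.card_univ, Fintype.card_embedding_eq, nsmul_eq_mul,
    Fintype.card_fin]

/-- A uniform lower bound for `n.descFactorial K * (p ^ K * (1 - β) ^ (n - K))` in the Poisson
regime, where `n * p` is bounded below and `n * β` is bounded above. -/
lemma poisson_lower_bound {n K : ℕ} {p β A κ : ℝ} (hn : 2 * K ≤ n) (hκ : 2 * κ ≤ n) (hp : 0 ≤ p)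
    (hA : 0 ≤ A) (hAp : A ≤ n * p) (hβ : 0 ≤ β) (hβκ : n * β ≤ κ) (hn0 : 0 < n) :
    (A / 2) ^ K * Real.exp (-(2 * κ)) ≤ n.descFactorial K * (p ^ K * (1 - β) ^ (n - K)) := by
  have hn' : (0 : ℝ) < n := by exact_mod_cast hn0
  have hβ2 : β ≤ 1 / 2 := by
    by_contra h
    nlinarith
  have h1 : ((n : ℝ) / 2) ^ K ≤ n.descFactorial K := by
    have h := Nat.pow_sub_le_descFactorial n K
    refine le_trans ?_ (show (((n + 1 - K : ℕ) : ℝ)) ^ K ≤ _ by exact_mod_cast h)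
    gcongr
    rw [Nat.cast_sub (by omega)]
    have : (2 : ℝ) * K ≤ n := by exact_mod_cast hn
    push_cast; linarith
  have h2 : Real.exp (-(2 * κ)) ≤ (1 - β) ^ (n - K) := by
    have h3 : Real.exp (-(2 * β)) ≤ 1 - β := by
      have h4 := Real.add_one_le_exp (2 * β)
      rw [Real.exp_neg]
      refine inv_le_of_inv_le₀ (by linarith) (le_trans ?_ h4)
      rw [inv_le_iff_one_le_mul₀ (by linarith)]
      nlinarith
    calc Real.exp (-(2 * κ)) ≤ Real.exp (n * -(2 * β)) := Real.exp_le_exp.2 (by nlinarith)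
      _ = Real.exp (-(2 * β)) ^ n := Real.exp_nat_mul _ _
      _ ≤ (1 - β) ^ n := pow_le_pow_left₀ (Real.exp_pos _).le h3 n
      _ ≤ (1 - β) ^ (n - K) := pow_le_pow_of_le_one (by linarith) (by linarith) (Nat.sub_le _ _)
  rw [← mul_assoc]
  refine mul_le_mul ?_ h2 (Real.exp_pos _).le (by positivity)
  calc (A / 2) ^ K ≤ (n / 2 * p) ^ K := pow_le_pow_left₀ (by positivity) (by linarith) K
    _ = (n / 2) ^ K * p ^ K := mul_pow _ _ _
    _ ≤ _ := by gcongr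

/-! ### Uniform points in the unit cube -/

lemma measurableSet_unitCube (d : ℕ) : MeasurableSet (unitCube d) := by
  have : unitCube d = ⋂ i, (fun x : EuclideanSpace ℝ (Fin d) => x i) ⁻¹' Set.Icc 0 1 := by
    ext x; simp [unitCube]
  rw [this]
  exact MeasurableSet.iInter fun i => (by fun_prop : Measurable
    fun x : EuclideanSpace ℝ (Fin d) => x i) measurableSet_Icc

lemma volume_unitCube_ne_top (d : ℕ) : volume (unitCube d) ≠ ⊤ := by
  refine (measure_mono (t := Metric.closedBall 0 (√d)) fun x hx => ?_).trans_lt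
    measure_closedBall_lt_top |>.ne
  rw [mem_closedBall_zero_iff, EuclideanSpace.norm_eq]
  refine Real.sqrt_le_sqrt ?_
  calc ∑ i, ‖x i‖ ^ 2 ≤ ∑ _i : Fin d, (1 : ℝ) := Finset.sum_le_sum fun i _ => by
        rw [Real.norm_eq_abs, sq_abs]
        have := hx i
        exact pow_le_one₀ this.1 this.2
    _ = d := by simp

lemma volume_unitCube_ne_zero (d : ℕ) : volume (unitCube d) ≠ 0 := by
  obtain ⟨c, hc, -⟩ := exists_grid d one_pos
  refine fun h => (Metric.measure_ball_pos volume (c fun _ => 0) (r := ((1 : ℕ) : ℝ)⁻¹ / 2)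
    (by norm_num)).ne' (measure_mono_null (hc _) h)

/-- The uniform distribution gives mass proportional to `r ^ d` to balls of radius `r` in the cube.
-/
lemma exists_cond_unitCube_ball {d : ℕ} (hd : 0 < d) : ∃ κ : ℝ, 0 < κ ∧
    ∀ (x : EuclideanSpace ℝ (Fin d)) (r : ℝ), 0 ≤ r → Metric.ball x r ⊆ unitCube d →
      (ProbabilityTheory.cond volume (unitCube d)).real (Metric.ball x r) = κ * r ^ d := by
  have : Nonempty (Fin d) := ⟨⟨0, hd⟩⟩
  refine ⟨(volume (unitCube d)).toReal⁻¹ *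
    (volume (Metric.ball (0 : EuclideanSpace ℝ (Fin d)) 1)).toReal, ?_, fun x r hr hx => ?_⟩
  · exact mul_pos (inv_pos.2 (ENNReal.toReal_pos (volume_unitCube_ne_zero d)
      (volume_unitCube_ne_top d))) (ENNReal.toReal_pos
        (Metric.measure_ball_pos _ _ one_pos).ne' measure_ball_lt_top.ne)
  · rw [Measure.real, cond_apply (measurableSet_unitCube d), Set.inter_eq_right.2 hx,
      Measure.addHaar_ball _ _ hr, ENNReal.toReal_mul, ENNReal.toReal_mul, ENNReal.toReal_inv,
      ENNReal.toReal_ofReal (by positivity), finrank_euclideanSpace_fin]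
    ring

lemma measurable_optimalTourLength (d n : ℕ) :
    Measurable fun x : Fin n → EuclideanSpace ℝ (Fin d) => optimalTourLength x := by
  unfold optimalTourLength tourLength
  refine Measurable.iInf fun σ => Finset.measurable_sum _ fun i _ => ?_
  exact (measurable_pi_apply _).dist (measurable_pi_apply _)

/-- A mesh size comparable with `n ^ (-1 / d)`. -/
lemma exists_mesh {d n : ℕ} (hd : 0 < d) (hn : 0 < n) :
    ∃ M : ℕ, 0 < M ∧ M ^ d ≤ n ∧ n ≤ (2 * M) ^ d := by
  have hex : ∃ M : ℕ, n < (M + 1) ^ d :=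
    ⟨n, (Nat.lt_succ_self n).trans_le (Nat.le_self_pow hd.ne' _)⟩
  classical
  have hspec := Nat.find_spec hex
  set M := Nat.find hex with hM
  have hM0 : 0 < M := by
    rcases M.eq_zero_or_pos with h | h
    · rw [h] at hspec; simp at hspec; omega
    · exact h
  refine ⟨M, hM0, ?_, hspec.le.trans (Nat.pow_le_pow_left (by omega) d)⟩
  have := Nat.find_min hex (m := M - 1) (by omega)
  rw [Nat.sub_add_cancel hM0] at this
  omega

/-- The number `M ^ d` of gadgets and their size `1 / M` produce the exponent `1 / 2 - 1 / d = (d -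
2) / (2 d)`. -/
lemma rpow_le_of_mesh {d n M : ℕ} (hd : 2 ≤ d) (hM : 0 < M) (h : n ≤ (2 * M) ^ d) :
    (n : ℝ) ^ (((d : ℝ) - 2) / (2 * (d : ℝ))) ≤
      2 ^ (((d : ℝ) - 2) / 2) * ((M : ℝ)⁻¹ * √((M : ℝ) ^ d)) := by
  have hM' : (0 : ℝ) < M := by exact_mod_cast hM
  have hd' : (2 : ℝ) ≤ d := by exact_mod_cast hd
  calc (n : ℝ) ^ (((d : ℝ) - 2) / (2 * (d : ℝ)))
      ≤ (((2 : ℝ) * M) ^ d) ^ (((d : ℝ) - 2) / (2 * (d : ℝ))) :=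
        Real.rpow_le_rpow (by positivity) (by exact_mod_cast h)
          (div_nonneg (by linarith) (by positivity))
    _ = ((2 : ℝ) * M) ^ (((d : ℝ) - 2) / 2) := by
        rw [← Real.rpow_natCast, ← Real.rpow_mul (by positivity)]
        congr 1
        field_simp
    _ = 2 ^ (((d : ℝ) - 2) / 2) * ((M : ℝ)⁻¹ * √((M : ℝ) ^ d)) := by
        rw [Real.mul_rpow (by norm_num) hM'.le, Real.sqrt_eq_rpow, ← Real.rpow_natCast,
          ← Real.rpow_mul hM'.le, ← Real.rpow_neg_one, ← Real.rpow_add hM']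
        congr 2
        ring

/-- The fluctuation bound for the product measure. -/
lemma exists_fluctuation_bound {d : ℕ} (hd : 2 ≤ d) : ∃ c₁ c₂ : ℝ, 0 < c₁ ∧ 0 < c₂ ∧ ∃ N : ℕ,
    ∀ n : ℕ, N ≤ n → ∀ a b : ℝ, b - a ≤ c₁ * (n : ℝ) ^ (((d : ℝ) - 2) / (2 * (d : ℝ))) →
      (Measure.pi fun _ : Fin n => ProbabilityTheory.cond volume (unitCube d)).real
        {x | a ≤ optimalTourLength x ∧ optimalTourLength x ≤ b} ≤ 1 - c₂ := by
  obtain ⟨T, hT⟩ := exists_finset_cover_sphere (E := EuclideanSpace ℝ (Fin d))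
  -- more than two cluster points per possible exit direction, so that some point of the cluster has
  -- both of its tour neighbours inside
  set k := max (2 * T.card + 1) 3 with hk
  obtain ⟨g⟩ := exists_gadget hd k
  obtain ⟨κ, hκ, hball⟩ := exists_cond_unitCube_ball (d := d) (by omega)
  have hprob : IsProbabilityMeasure (ProbabilityTheory.cond volume (unitCube d)) :=
    cond_isProbabilityMeasure_of_finite (volume_unitCube_ne_zero d) (volume_unitCube_ne_top d)
  have hρ := g.ρ_pos
  have hδ := g.δ_pos
  set K := Fintype.card (Fin k ⊕ Fin k) with hK
  set p : ℝ := (κ * g.ρ ^ d / 2) ^ K * Real.exp (-(2 * κ)) with hp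
  have hp0 : 0 < p := by positivity
  set A : ℝ := 2 ^ (((d : ℝ) - 2) / 2) with hA
  have hA0 : 0 < A := by positivity
  -- `2 κ ≤ n` keeps the mass of a gadget ball below `1 / 2`, and the second bound makes the expected
  -- number of occupied gadgets at least `128`
  obtain ⟨N, hN⟩ := exists_nat_ge (max (2 * κ) (2 ^ d * (64 / (p / 2))))
  refine ⟨g.δ / 2 * (√(p / 2) / 8) / A, p / 4, by positivity, by positivity,
    max (max N (2 * K)) 1, fun n hn a b hab => ?_⟩
  have hn0 : 0 < n := by omega
  have hnN : (N : ℝ) ≤ n := by exact_mod_cast (by omega : N ≤ n)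
  obtain ⟨M, hM, hMn, hnM⟩ := exists_mesh (d := d) (by omega) hn0
  have hM' : (0 : ℝ) < M := by exact_mod_cast hM
  set s : ℝ := (M : ℝ)⁻¹ with hs
  have hs0 : 0 < s := by positivity
  obtain ⟨c, hcube, hc⟩ := exists_grid d hM
  have hMs : (M : ℝ) ^ d * s ^ d = 1 := by rw [hs, ← mul_pow, mul_inv_cancel₀ hM'.ne', one_pow]
  have hns1 : 1 ≤ n * s ^ d := by
    rw [← hMs]
    exact mul_le_mul_of_nonneg_right (by exact_mod_cast hMn) (by positivity)
  have hns2 : n * s ^ d ≤ 2 ^ d := by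
    calc n * s ^ d ≤ (2 * M : ℝ) ^ d * s ^ d :=
          mul_le_mul_of_nonneg_right (by exact_mod_cast hnM) (by positivity)
      _ = 2 ^ d := by rw [mul_pow, mul_assoc, hMs, mul_one]
  have hregion : ∀ j t, (ProbabilityTheory.cond volume (unitCube d)).real (g.region (c j) s t) =
      κ * (s * g.ρ) ^ d := fun j t =>
    hball _ _ (by positivity) ((g.region_subset_ball hs0 t).trans (hcube j))
  have hBall : ∀ j, (ProbabilityTheory.cond volume (unitCube d)).real
      (Metric.ball (c j) (s / 2)) = κ * (s / 2) ^ d := fun j =>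
    hball _ _ (by positivity) (hcube j)
  have hOn := fun j => measureReal_pi_exists_embedding
    (ProbabilityTheory.cond volume (unitCube d)) (R := g.region (c j) s)
    (B := Metric.ball (c j) (s / 2)) n (fun t => measurableSet_ball) measurableSet_ball
    (g.region_subset_ball hs0) (fun t t' h => g.disjoint_region hs0 h) (hregion j)
  have hcard : Fintype.card (Fin d → Fin M) = M ^ d := by simp
  have hcores : ∀ W : Finset (Fin d → Fin M), MeasurableSet (g.cores c s W) := fun W =>
    (isOpen_biUnion fun j _ => isOpen_iUnion fun i => Metric.isOpen_ball).measurableSet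
  refine measureReal_Icc_le_of_moves (ι := Fin d → Fin M)
    (T := fun W x i => swapMap (g.cores c s W) (s • g.w) (x i))
    (On := fun j => {x | g.IsOn (c j) s x}) (ε := s * (g.δ / 2))
    (fun W => measurePreserving_pi _ _ fun _ => measurePreserving_swapMap_cond volume (hcores W)
      (measurableSet_unitCube d) (fun y hy => g.sub_notMem_cores hs0 hc hy) fun y hy => ?_)
    (measurable_optimalTourLength d n) (fun j => (hOn j).1) (by positivity) (fun j => ?_)
    (fun j x hx W hj => ?_) ?_ ?_
  · obtain ⟨j, -, hj⟩ := g.mem_cores.1 hy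
    exact ⟨hcube j (g.mem_ball_of_mem_core hs0 hj), hcube j (g.add_mem_ball_of_mem_core hs0 hj)⟩
  · refine le_trans ?_ (hOn j).2.ge
    rw [hBall]
    refine poisson_lower_bound (by omega) ((le_max_left _ _).trans (hN.trans hnN)) (by positivity)
      (by positivity) ?_ (by positivity) ?_ hn0
    · rw [mul_pow]
      have : 0 ≤ κ * g.ρ ^ d := by positivity
      nlinarith
    · rw [div_pow]
      calc n * (κ * (s ^ d / 2 ^ d)) = κ * (n * s ^ d / 2 ^ d) := by ring
        _ ≤ κ * 1 := by gcongr; rw [div_le_one (by positivity)]; exact hns2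
        _ = κ := mul_one κ
  · simp only [optimalTourLength_eq_tsp]
    exact g.tsp_swap_insert_add_le hT (by omega) (by omega) hs0 hc hx hj
  · rw [hcard, ← div_le_iff₀ (by positivity)]
    have h1 := (le_max_right _ _).trans (hN.trans hnN)
    have h2 : (n : ℝ) ≤ 2 ^ d * M ^ d := by rw [← mul_pow]; exact_mod_cast hnM
    have h3 := h1.trans h2
    push_cast
    exact le_of_mul_le_mul_left h3 (by positivity)
  · refine hab.trans ?_
    have h := rpow_le_of_mesh hd hM hnM
    rw [hcard]
    push_cast
    rw [Real.sqrt_mul (by positivity)]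
    calc _ ≤ g.δ / 2 * (√(p / 2) / 8) / A * (A * (s * √((M : ℝ) ^ d))) := by gcongr
      _ = _ := by field_simp

theorem mainTheorem9 (d : ℕ) (hd : 2 ≤ d)
    {Ω : ℕ → Type*} [∀ n, MeasurableSpace (Ω n)]
    (P : ∀ n, Measure (Ω n)) [∀ n, IsProbabilityMeasure (P n)]
    (X : ∀ n, Fin n → Ω n → EuclideanSpace ℝ (Fin d))
    (hindep : ∀ n, iIndepFun (X n) (P n))
    (hunif : ∀ n i, pdf.IsUniform (X n i) (unitCube d) (P n) volume) :
    FluctuationsAtLeast P (fun n ω => optimalTourLength (fun i => X n i ω))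
      (fun n => (n : ℝ) ^ (((d : ℝ) - 2) / (2 * (d : ℝ)))) := by
  obtain ⟨c₁, c₂, h₁, h₂, N, h⟩ := exists_fluctuation_bound hd
  refine ⟨c₁, c₂, h₁, h₂, N, fun n hn a b _ hab => ?_⟩
  have hm : ∀ i, AEMeasurable (X n i) (P n) := fun i =>
    (hunif n i).aemeasurable (volume_unitCube_ne_zero d) (volume_unitCube_ne_top d)
  have hlaw : (P n).map (fun ω i => X n i ω) =
      Measure.pi fun _ : Fin n => ProbabilityTheory.cond volume (unitCube d) := by
    rw [(iIndepFun_iff_map_fun_eq_pi_map hm).1 (hindep n)]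
    exact congrArg Measure.pi (funext fun i => hunif n i)
  have hS : MeasurableSet {x : Fin n → EuclideanSpace ℝ (Fin d) |
      a ≤ optimalTourLength x ∧ optimalTourLength x ≤ b} :=
    measurable_optimalTourLength d n measurableSet_Icc
  have hbound := h n hn a b hab
  rw [← hlaw, measureReal_def, Measure.map_apply_of_aemeasurable (aemeasurable_pi_lambda _ hm) hS]
    at hbound
  exact hbound
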